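/- A sequence $\Lambda=\{\lambda_n\}_{n\ge1}$ belongs to the class $\mathcal S$ if it is positive and nondecreasing, $\lambda_n\to\infty$ and $\sum_{n\ge1}1/\lambda_n=\infty$. For $\Lambda\in\mathcal S$, $\Lambda BV$ denotes the class of 1-periodic functions $f:\mathbb R\to\mathbb R$ with $\sup\sum_{n\ge1}|f(b_n)-f(a_n)|/\lambda_n<\infty$, where the supremum is over all sequences of nonoverlapping intervals $[a_n,b_n]$ contained in a period. For $1<p<\infty$ and $0<\alpha<1$, $\mathrm{Lip}(\alpha;p)$ denotes the class of 1-periodic measurable $f:\mathbb R\to\mathbb R$ with $\int_0^1|f|^p<\infty$ and $$\sup_{0\le h\le\delta}\left(\int_0^1|f(x+h)-f(x)|^p\,dx\right)^{1/p}=O(\delta^\alpha)\qquad(0\le\delta\le1).$$ The inclusion $\mathrm{Lip}(\alpha;p)\subset\Lambda BV$ means that every $f\in\mathrm{Lip}(\alpha;p)$ can be modified on a set of measure zero to become continuous, and that the modified function belongs to $\Lambda BV$. **Theorem.** Let $1<p<\infty$, $1/p<\alpha<1$, $p'=p/(p-1)$ and $r'=1/(1+1/p-\alpha)$ (the conjugate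 exponent of $r=1/(\alpha-1/p)$). Then for every $\Lambda\in\mathcal S$, the inclusion $\mathrm{Lip}(\alpha;p)\subset\Lambda BV$ holds if and only if $$\sum_{n=0}^\infty\left(\sum_{k=2^n}^{2^{n+1}}\left(\frac{1}{k^{\alpha-1/p}\lambda_k}\right)^{p'}\right)^{r'/p'}<\infty.$$ Consequently, Wang's conjecture, that the condition $\sum_{n=1}^\infty\lambda_n^{-1/(1-\alpha)}<\infty$ is sufficient for $\mathrm{Lip}(\alpha;p)\subset\Lambda BV$, is not true: for all such $p$ and $\alpha$ there is $\Lambda\in\mathcal S$ with $\sum_{n=1}^\infty\lambda_n^{-1/(1-\alpha)}<\infty$ and $\mathrm{Lip}(\alpha;p)\not\subset\Lambda BV$. -/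

import Mathlib

open MeasureTheory Set Filter
open scoped ENNReal NNReal Topology

/-- The class `𝒮` of sequences `Λ = (l 1, l 2, …)`: positive, nondecreasing, tending to infinity,
with divergent sum of reciprocals. Sequences are indexed from `1`; the value `l 0` is never used. -/
structure IsLambdaSeq (l : ℕ → ℝ) : Prop where
  pos : ∀ n, 1 ≤ n → 0 < l n
  mono : ∀ m n, 1 ≤ m → m ≤ n → l m ≤ l n
  tendsto : Tendsto l atTop atTop
  not_summable : ¬ Summable (fun n : ℕ => 1 / l (n + 1))

/-- The intervals `[a n, b n]`, `n = 0, 1, 2, …`, are nonoverlapping and contained in a common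
period `[x₀, x₀ + 1]`. Degenerate intervals are allowed, so that finite families are covered. -/
structure IsNonoverlappingSeq (a b : ℕ → ℝ) : Prop where
  le : ∀ n, a n ≤ b n
  period : ∃ x₀ : ℝ, ∀ n, x₀ ≤ a n ∧ b n ≤ x₀ + 1
  disjoint : ∀ m n, m ≠ n → Disjoint (Ioo (a m) (b m)) (Ioo (a n) (b n))

/-- The `Λ`-variation of `f`, with values in `[0, ∞]`: the `n`-th interval of a sequence
(counted from `0`) has weight `1 / l (n + 1)`. -/
noncomputable def lambdaVariation (l : ℕ → ℝ) (f : ℝ → ℝ) : ℝ≥0∞ :=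
  ⨆ (a : ℕ → ℝ) (b : ℕ → ℝ) (_ : IsNonoverlappingSeq a b),
    ∑' n : ℕ, ENNReal.ofReal (|f (b n) - f (a n)| / l (n + 1))

/-- The class `ΛBV` of `1`-periodic functions of bounded `Λ`-variation. -/
def LambdaBV (l : ℕ → ℝ) : Set (ℝ → ℝ) :=
  {f | Function.Periodic f 1 ∧ lambdaVariation l f < ∞}

/-- The `L^p`-modulus of continuity of `f` (over one period), with values in `[0, ∞]`. -/
noncomputable def lpModulus (p : ℝ) (f : ℝ → ℝ) (δ : ℝ) : ℝ≥0∞ :=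
  ⨆ h ∈ Icc (0 : ℝ) δ,
    eLpNorm (fun x => f (x + h) - f x) (ENNReal.ofReal p) (volume.restrict (Icc 0 1))

/-- The integral Lipschitz class `Lip(α; p)`: the `1`-periodic functions in `L^p` with
`L^p`-modulus of continuity `O(δ^α)` on `[0, 1]`. -/
def LipClass (α p : ℝ) : Set (ℝ → ℝ) :=
  {f | Function.Periodic f 1 ∧
    MemLp f (ENNReal.ofReal p) (volume.restrict (Icc 0 1)) ∧
    ∃ C : ℝ≥0, ∀ δ ∈ Icc (0 : ℝ) 1, lpModulus p f δ ≤ C * ENNReal.ofReal (δ ^ α)}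

/-- The inclusion `Lip(α; p) ⊂ ΛBV`. Elements of `Lip(α; p)` are determined up to null sets, so the
inclusion says: every `f` in `Lip(α; p)` can be modified on a set of measure zero to become
continuous, and the modified function is of bounded `Λ`-variation. -/
def LipSubsetLambdaBV (α p : ℝ) (l : ℕ → ℝ) : Prop :=
  ∀ f ∈ LipClass α p, ∃ g : ℝ → ℝ, Continuous g ∧ g =ᵐ[volume] f ∧ g ∈ LambdaBV l

/-!
Write `β = α - 1 / p` and `c n = 2 ^ (n (1 - α)) / l (2 ^ n)` (`dyadicRatio`), so that
`1 / r' = 1 - β`. Since `l` is nondecreasing, each block sum of the theorem is comparable with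
`c n ^ p'`, and the block condition says `∑ c n ^ r' < ∞` (`summable_blocks_iff`).

**Sufficiency.** Two Steklov means of `f` over adjacent or nested dyadic fractions of an interval
differ by an integral of `f (x + h) - f x` with a *fixed* step `h`. Hence the means of step
`2 ^ (-i)` converge uniformly, to a continuous function equal to `f` almost everywhere
(`exists_continuous_ae_eq`). The same comparison, carried out inside each of a family of
nonoverlapping intervals of comparable length and summed by Minkowski's inequality, shows that the
increments over intervals of length at most `t` have `ℓ^p` norm `O(t ^ β)`
(`exists_sum_abs_rpow_le`). Now sort the intervals by decreasing length `t 0 ≥ t 1 ≥ …`. By Hölder's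
inequality the `2 ^ k` intervals of the `k`-th dyadic block of this ordering contribute at most a
constant times `(2 ^ k t_k) ^ β e k` to the variation, where `t_k` is the longest length in the
block and `e k` is `2 ^ (-k β)` times the `ℓ^p'` norm of the first `2 ^ k` weights. As
`∑ 2 ^ k t_k = O(1)` because the intervals lie in one period, and `e` is in `ℓ^r'` together with `c`,
Hölder's inequality with exponents `1 / β` and `r'` bounds the sum
(`sum_mul_le_of_length_bound`).

**Necessity.** If `∑ c n ^ r' = ∞`, the Abel–Dini theorem yields `μ k > 0` with `∑ μ k ≤ 1` and
`∑ μ k ^ β c (k + 1) = ∞`, and such that the numbers `δ k = μ k / 2 ^ k` decay geometrically. Place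
side by side, for each `k`, `2 ^ k` tents of width `δ k` and height `δ k ^ α μ k ^ (-1 / p)`. Each
group has `L^p` norm about `δ k ^ α` and lives at scale `δ k`, so the sum is in `Lip (α; p)`
(`exists_mem_lipClass_of_widths`), while giving the weights `1 / l n`, `2 ^ k ≤ n < 2 ^ (k + 1)`, to
the `k`-th group makes its `Λ`-variation at least a constant times `∑ μ k ^ β c (k + 1)`.

**Wang's condition** says `c ∈ ℓ^(1 / (1 - α))`, which is weaker than `c ∈ ℓ^r'` because `β < α`; the
sequence with `c n = (n + 1) ^ (-1 / r')` satisfies the former only (`logPowerSeq`).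
-/

/-! ### Dyadic blocks and rearrangements -/

/-- An antitone sequence summed over a finite set is largest on the initial segment of the same
size. -/
theorem sum_le_sum_range_card_of_antitone {w : ℕ → ℝ} (hw : Antitone w) (s : Finset ℕ) :
    ∑ i ∈ s, w i ≤ ∑ i ∈ Finset.range s.card, w i := by
  induction s using Finset.induction_on_max with
  | empty => simp
  | insert a s ha ih =>
    have hna : a ∉ s := fun h => lt_irrefl _ (ha a h)
    have hcard : s.card ≤ a := by
      simpa using
        Finset.card_le_card (fun x hx => Finset.mem_range.2 (ha x hx) : s ⊆ Finset.range a)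
    rw [Finset.sum_insert hna, Finset.card_insert_of_notMem hna, Finset.sum_range_succ, add_comm]
    exact add_le_add ih (hw hcard)

/-- Splitting `[0, 2 ^ K - 1)` into the blocks `[2 ^ k - 1, 2 ^ (k + 1) - 1)`: after the shift of
indices by one, these are the dyadic blocks of the weights `1 / l (n + 1)`. -/
theorem sum_range_two_pow_sub_one {M : Type*} [AddCommMonoid M] (F : ℕ → M) (K : ℕ) :
    ∑ n ∈ Finset.range (2 ^ K - 1), F n
      = ∑ k ∈ Finset.range K, ∑ i ∈ Finset.range (2 ^ k), F (2 ^ k - 1 + i) := by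
  induction K with
  | zero => simp
  | succ K ih =>
    have h : 2 ^ (K + 1) - 1 = (2 ^ K - 1) + 2 ^ K := by
      have := Nat.one_le_two_pow (n := K); rw [pow_succ]; omega
    rw [h, Finset.sum_range_add, ih, Finset.sum_range_succ]

theorem log_two_block {k i : ℕ} (hi : i < 2 ^ k) : Nat.log 2 (2 ^ k - 1 + i + 1) = k := by
  have := Nat.one_le_two_pow (n := k)
  apply Nat.log_eq_of_pow_le_of_lt_pow
  · omega
  · rw [pow_succ]; omega

theorem sum_range_two_pow_sub_one_log {M : Type*} [AddCommMonoid M] (F : ℕ → M) (K : ℕ) :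
    ∑ n ∈ Finset.range (2 ^ K - 1), F (Nat.log 2 (n + 1))
      = ∑ k ∈ Finset.range K, 2 ^ k • F k := by
  rw [sum_range_two_pow_sub_one]
  refine Finset.sum_congr rfl fun k _ => ?_
  rw [Finset.sum_congr rfl fun i hi => by rw [log_two_block (Finset.mem_range.1 hi)]]
  simp

/-! ### Numerical series -/

/-- A sequence with `e (k + 1) ≤ θ (e k + c k)`, `θ < 1`, is controlled in `ℓ^q` by `c`. -/
theorem sum_rpow_le_of_recursion {e c : ℕ → ℝ} {θ q : ℝ} (hθ0 : 0 < θ) (hθ1 : θ < 1) (hq : 1 ≤ q)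
    (he : ∀ k, 0 ≤ e k) (hc : ∀ k, 0 ≤ c k) (hrec : ∀ k, e (k + 1) ≤ θ * (e k + c k))
    (hsum : Summable fun k => c k ^ q) :
    ∃ R, ∀ M, ∑ k ∈ Finset.range M, e k ^ q ≤ R := by
  set D : ℝ := (1 - θ) * (θ / (1 - θ)) ^ q with hD
  have h1θ : 0 < 1 - θ := by linarith
  have hD0 : 0 ≤ D := by positivity
  have hstep : ∀ k, e (k + 1) ^ q ≤ θ * e k ^ q + D * c k ^ q := by
    intro k
    have h1 : e (k + 1) ≤ θ * e k + (1 - θ) * (θ / (1 - θ) * c k) := by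
      refine (hrec k).trans (le_of_eq ?_)
      field_simp
    have h2 := (convexOn_rpow hq).2 (x := e k) (he k) (y := θ / (1 - θ) * c k)
      (mul_nonneg (by positivity) (hc k)) hθ0.le h1θ.le (by ring)
    simp only [smul_eq_mul] at h2
    refine (Real.rpow_le_rpow (he _) h1 (by linarith)).trans (h2.trans (le_of_eq ?_))
    rw [Real.mul_rpow (by positivity) (hc k), hD]
    ring
  refine ⟨(e 0 ^ q + D * ∑' k, c k ^ q) / (1 - θ), fun M => ?_⟩
  rw [le_div_iff₀ h1θ]
  have hcq : ∀ k, 0 ≤ c k ^ q := fun k => Real.rpow_nonneg (hc k) q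
  have hC := hsum.sum_le_tsum (Finset.range M) (fun k _ => hcq k)
  have h3 : ∑ k ∈ Finset.range (M + 1), e k ^ q
      ≤ e 0 ^ q + (θ * ∑ k ∈ Finset.range M, e k ^ q + D * ∑ k ∈ Finset.range M, c k ^ q) := by
    rw [Finset.sum_range_succ', add_comm, Finset.mul_sum, Finset.mul_sum, ← Finset.sum_add_distrib]
    gcongr with k hk
    exact hstep k
  rw [Finset.sum_range_succ] at h3
  have h4 : 0 ≤ e M ^ q := Real.rpow_nonneg (he M) q
  nlinarith [mul_le_mul_of_nonneg_left hC hD0]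

/-- For a positive sequence decaying at least geometrically, `∑ min (z ^ A) (z ^ (-B))` is bounded
by a constant independent of the sequence: the sum is dominated by the terms near `z = 1`. -/
theorem sum_min_rpow_le {z : ℕ → ℝ} {θ A B : ℝ} (hθ0 : 0 < θ) (hθ1 : θ < 1) (hA : 0 < A)
    (hB : 0 < B) (hz : ∀ k, 0 < z k) (hrec : ∀ k, z (k + 1) ≤ θ * z k) (K : ℕ) :
    ∑ k ∈ Finset.range K, min (z k ^ A) (z k ^ (-B)) ≤ 1 / (1 - θ ^ A) + 1 / (1 - θ ^ B) := by
  have hA1 : 0 < 1 - θ ^ A := by linarith [Real.rpow_lt_one hθ0.le hθ1 hA]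
  have hB1 : 0 < 1 - θ ^ B := by linarith [Real.rpow_lt_one hθ0.le hθ1 hB]
  -- Two bounded monotone potentials whose decrements dominate the terms with `z ≤ 1` and `1 ≤ z`.
  set Φ : ℝ → ℝ := fun x => min 1 x ^ A / (1 - θ ^ A) with hΦ
  set Ψ : ℝ → ℝ := fun x => max 1 (x / θ) ^ (-B) / (1 - θ ^ B) with hΨ
  have hΦmono : ∀ x y, 0 < x → x ≤ y → Φ x ≤ Φ y := by
    intro x y hx hxy
    simp only [hΦ]
    gcongr
  have hΨanti : ∀ x y, x ≤ y → Ψ y ≤ Ψ x := by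
    intro x y hxy
    simp only [hΨ]
    refine div_le_div_of_nonneg_right ?_ hB1.le
    exact Real.rpow_le_rpow_of_nonpos (by positivity) (by gcongr) (by linarith)
  have key : ∀ x, 0 < x → min (x ^ A) (x ^ (-B)) ≤ (Φ x - Φ (θ * x)) + (Ψ (θ * x) - Ψ x) := by
    intro x hx
    have hθx : θ * x ≤ x := by nlinarith
    have h1 : 0 ≤ Φ x - Φ (θ * x) := sub_nonneg.2 (hΦmono _ _ (by positivity) hθx)
    have h2 : 0 ≤ Ψ (θ * x) - Ψ x := sub_nonneg.2 (hΨanti _ _ hθx)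
    rcases le_total x 1 with h | h
    · have : x ^ A = Φ x - Φ (θ * x) := by
        simp only [hΦ]
        rw [min_eq_right h, min_eq_right (hθx.trans h), Real.mul_rpow hθ0.le hx.le]
        field_simp
      exact (min_le_left _ _).trans (by linarith)
    · have : x ^ (-B) = Ψ (θ * x) - Ψ x := by
        have h3 : θ * x / θ = x := by field_simp
        have h4 : 1 ≤ x / θ := by rw [le_div_iff₀ hθ0]; linarith
        simp only [hΨ]
        rw [h3, max_eq_right h, max_eq_right h4, Real.div_rpow hx.le hθ0.le, Real.rpow_neg hθ0.le]
        field_simp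
      exact (min_le_right _ _).trans (by linarith)
  have hsum : ∀ K, ∑ k ∈ Finset.range K, min (z k ^ A) (z k ^ (-B))
      ≤ (Φ (z 0) - Φ (z K)) + (Ψ (z K) - Ψ (z 0)) := by
    intro K
    induction K with
    | zero => simp
    | succ K ih =>
      rw [Finset.sum_range_succ]
      have h1 := key _ (hz K)
      have h2 := hΦmono _ _ (hz (K + 1)) (hrec K)
      have h3 := hΨanti _ _ (hrec K)
      linarith
  have h1 : Φ (z 0) ≤ 1 / (1 - θ ^ A) := by
    simp only [hΦ]
    gcongr
    exact Real.rpow_le_one (le_min zero_le_one (hz 0).le) (min_le_left _ _) hA.le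
  have h2 : 0 ≤ Φ (z K) := by
    have := hz K
    simp only [hΦ]; positivity
  have h3 : Ψ (z K) ≤ 1 / (1 - θ ^ B) := by
    simp only [hΨ]
    gcongr
    exact Real.rpow_le_one_of_one_le_of_nonpos (le_max_left _ _) (by linarith)
  have h4 : 0 ≤ Ψ (z 0) := by simp only [hΨ]; positivity
  linarith [hsum K]

/-- Abel–Dini, convergence half: if `G` are the partial sums of `a`, shifted to start from `1`, then
`∑ a / G ^ s` converges for `s > 1`. -/
theorem summable_div_partialSum_rpow {a : ℕ → ℝ} (ha : ∀ k, 0 < a k) {s : ℝ} (hs : 1 < s) :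
    Summable fun k => a k / (1 + ∑ j ∈ Finset.range (k + 1), a j) ^ s := by
  set G : ℕ → ℝ := fun k => 1 + ∑ j ∈ Finset.range k, a j with hG
  have hG1 : ∀ k, 1 ≤ G k := fun k => by
    simp only [hG]; linarith [Finset.sum_nonneg fun j (_ : j ∈ Finset.range k) => (ha j).le]
  have hGs : ∀ k, G (k + 1) = G k + a k := fun k => by
    simp only [hG, Finset.sum_range_succ]; ring
  have hs1 : 0 < s - 1 := by linarith
  have hstep : ∀ k, a k / G (k + 1) ^ s
      ≤ (G k ^ (1 - s) - G (k + 1) ^ (1 - s)) / (s - 1) := by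
    intro k
    have hx : 0 < G k := by linarith [hG1 k]
    have hy : 0 < G (k + 1) := by linarith [hG1 (k + 1)]
    set u := G k / G (k + 1) with hu
    have hu0 : 0 < u := by positivity
    have h1 : G k = u * G (k + 1) := by rw [hu]; field_simp
    have h2 : a k = (1 - u) * G (k + 1) := by rw [sub_mul, ← h1, hGs]; ring
    -- Tangent line of the convex function `u ↦ u ^ (1 - s)` at `1`, via `exp`.
    have h3 : (s - 1) * (1 - u) ≤ u ^ (1 - s) - 1 := by
      rw [Real.rpow_def_of_pos hu0]
      have := Real.add_one_le_exp (Real.log u * (1 - s))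
      have := Real.log_le_sub_one_of_pos hu0
      nlinarith
    have h4 : G (k + 1) ^ s = G (k + 1) * G (k + 1) ^ (s - 1) := by
      rw [← Real.rpow_one_add' hy.le (by linarith)]; ring_nf
    have h5 : G (k + 1) ^ (1 - s) = (G (k + 1) ^ (s - 1))⁻¹ := by
      rw [← Real.rpow_neg hy.le]; ring_nf
    rw [h4, h1, Real.mul_rpow hu0.le hy.le, h5, h2, le_div_iff₀ hs1]
    have h6 : 0 < G (k + 1) ^ (s - 1) := Real.rpow_pos_of_pos hy _
    have : (1 - u) * G (k + 1) / (G (k + 1) * G (k + 1) ^ (s - 1)) * (s - 1)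
        = (s - 1) * (1 - u) * (G (k + 1) ^ (s - 1))⁻¹ := by field_simp
    rw [this]
    have h7 := mul_le_mul_of_nonneg_right h3 (inv_nonneg.2 h6.le)
    linarith
  refine summable_of_sum_range_le (c := 1 / (s - 1)) (fun k => ?_) fun n => ?_
  · exact div_nonneg (ha k).le (Real.rpow_nonneg (by linarith [hG1 (k + 1)]) _)
  · have h := Finset.sum_le_sum fun k (_ : k ∈ Finset.range n) => hstep k
    rw [← Finset.sum_div, Finset.sum_range_sub'] at h
    refine h.trans ?_
    have h0 : G 0 = 1 := by simp [hG]
    have hn : 0 ≤ G n ^ (1 - s) := Real.rpow_nonneg (by linarith [hG1 n]) _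
    rw [h0, Real.one_rpow]
    gcongr
    linarith

/-- Abel–Dini, divergence half: dividing a divergent series by its partial sums keeps it
divergent. -/
theorem not_summable_div_partialSum {a : ℕ → ℝ} (ha : ∀ k, 0 < a k) (hdiv : ¬ Summable a) :
    ¬ Summable fun k => a k / (1 + ∑ j ∈ Finset.range (k + 1), a j) := by
  set G : ℕ → ℝ := fun k => 1 + ∑ j ∈ Finset.range k, a j with hG
  have hG1 : ∀ k, 1 ≤ G k := fun k => by
    simp only [hG]; linarith [Finset.sum_nonneg fun j (_ : j ∈ Finset.range k) => (ha j).le]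
  have htop : Tendsto G atTop atTop :=
    tendsto_atTop_add_const_left _ _
      ((not_summable_iff_tendsto_nat_atTop_of_nonneg fun k => (ha k).le).1 hdiv)
  have hGmono : Monotone G := monotone_nat_of_le_succ fun k => by
    simp only [hG, Finset.sum_range_succ]; linarith [ha k]
  intro hsum
  have hnn : ∀ k, 0 ≤ a k / G (k + 1) := fun k =>
    div_nonneg (ha k).le (by linarith [hG1 (k + 1)])
  -- Each tail of the series is at least `(G n - G m) / G n`, which tends to `1`.
  obtain ⟨m, hm⟩ := ((tendsto_sum_nat_add fun k => a k / G (k + 1)).eventually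
    (gt_mem_nhds (show (0 : ℝ) < 1 / 2 by norm_num))).exists
  obtain ⟨n, hn, hn'⟩ := ((htop.eventually_ge_atTop (2 * G m)).and
    (eventually_ge_atTop m)).exists
  obtain ⟨d, rfl⟩ := Nat.exists_eq_add_of_le hn'
  have hGn : 0 < G (m + d) := by linarith [hG1 (m + d)]
  have h1 := (((summable_nat_add_iff m).2 hsum).sum_le_tsum (Finset.range d)
    fun k _ => hnn (k + m))
  have h2 : ∑ k ∈ Finset.range d, a (k + m) / G (m + d)
      ≤ ∑ k ∈ Finset.range d, a (k + m) / G (k + m + 1) := by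
    refine Finset.sum_le_sum fun k hk => ?_
    have h3 : G (k + m + 1) ≤ G (m + d) := hGmono (by have := Finset.mem_range.1 hk; omega)
    exact div_le_div_of_nonneg_left (ha _).le (by linarith [hG1 (k + m + 1)]) h3
  have h4 : ∑ k ∈ Finset.range d, a (k + m) = G (m + d) - G m := by
    simp only [hG, Finset.sum_range_add, add_comm _ m]
    ring
  rw [← Finset.sum_div, h4] at h2
  have h5 : 1 / 2 ≤ (G (m + d) - G m) / G (m + d) := by
    rw [le_div_iff₀ hGn]; linarith
  linarith

/-! ### Weighted sums over intervals sorted by length -/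

/-- Every finitely supported nonnegative sequence can be rearranged decreasingly by a permutation
acting on an initial segment containing the support. -/
theorem exists_perm_antitone (N : ℕ) {x : ℕ → ℝ} (hx : ∀ n, 0 ≤ x n) (hN : ∀ n, N ≤ n → x n = 0) :
    ∃ σ : Equiv.Perm ℕ, (∀ n, N ≤ n → σ n = n) ∧ Antitone (x ∘ σ) := by
  set τ : Equiv.Perm (Fin N) := Tuple.sort fun i : Fin N => - x i with hτ
  have hmono : Monotone ((fun i : Fin N => - x i) ∘ τ) := Tuple.monotone_sort _
  set σ : Equiv.Perm ℕ := τ.extendDomain Fin.equivSubtype with hσ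
  have hfix : ∀ n, N ≤ n → σ n = n := fun n hn =>
    Equiv.Perm.extendDomain_apply_not_subtype _ _ (by omega)
  have hval : ∀ i : Fin N, σ i = τ i := fun i => by
    have := Equiv.Perm.extendDomain_apply_image τ Fin.equivSubtype i
    simpa using this
  refine ⟨σ, hfix, fun i j hij => ?_⟩
  simp only [Function.comp]
  rcases lt_or_ge j N with hj | hj
  · have h := hmono (show (⟨i, by omega⟩ : Fin N) ≤ ⟨j, hj⟩ from hij)
    have h1 := hval ⟨i, by omega⟩
    have h2 := hval ⟨j, hj⟩
    simp only [Function.comp] at h h1 h2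
    rw [h1, h2]
    linarith
  · rw [hfix j hj, hN j hj]
    exact hx _

/-- The combinatorial heart of the sufficiency part. The numbers `v n` are increments over intervals
of lengths `len n` and total length at most `1`; increments over intervals shorter than `t` are
bounded in `ℓ^p` by `K t ^ β`. Then `∑ v n * w n` is controlled by the sum `R` of the `q`-th powers
of the numbers `2 ^ (-k β) ‖(w 0, …, w (2 ^ k - 1))‖_p'`, where `1 / q = 1 - β`. The proof sorts the
intervals by decreasing length and splits them into dyadic blocks, the `k`-th of which consists of
`2 ^ k` intervals not longer than its first one. -/
theorem sum_mul_le_of_length_bound {p p' β q K R : ℝ} (hpp : p.HolderConjugate p')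
    (hβ0 : 0 < β) (hβ1 : β < 1) (hq : q = 1 / (1 - β)) (hK : 0 ≤ K)
    {v len w : ℕ → ℝ} (N : ℕ) (hv : ∀ n, 0 ≤ v n) (hlen : ∀ n, 0 ≤ len n)
    (hlen1 : ∑ n ∈ Finset.range N, len n ≤ 1) (hw0 : ∀ n, 0 ≤ w n) (hw : Antitone w)
    (hvlen : ∀ s ⊆ Finset.range N, ∀ t, 0 ≤ t → t ≤ 1 → (∀ n ∈ s, len n ≤ t) →
      ∑ n ∈ s, v n ^ p ≤ (K * t ^ β) ^ p)
    (hR : ∀ M, ∑ k ∈ Finset.range M,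
      ((2 : ℝ) ^ (-(k * β)) * (∑ i ∈ Finset.range (2 ^ k), w i ^ p') ^ (1 / p')) ^ q ≤ R) :
    ∑ n ∈ Finset.range N, v n * w n ≤ K * (3 + R) := by
  classical
  -- cut the sequences off at `N`
  set x : ℕ → ℝ := fun n => if n < N then len n else 0 with hxdef
  set y : ℕ → ℝ := fun n => if n < N then v n else 0 with hydef
  have hx0 : ∀ n, 0 ≤ x n := fun n => by simp only [hxdef]; split_ifs <;> simp [hlen]
  have hy0 : ∀ n, 0 ≤ y n := fun n => by simp only [hydef]; split_ifs <;> simp [hv]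
  have hxN : ∀ n, N ≤ n → x n = 0 := fun n hn => by simp [hxdef, not_lt.2 hn]
  have hppos : 0 < p := hpp.pos
  have hp'pos : 0 < p' := hpp.symm.pos
  have hxy : ∀ s : Finset ℕ, ∀ t, 0 ≤ t → t ≤ 1 → (∀ n ∈ s, x n ≤ t) →
      ∑ n ∈ s, y n ^ p ≤ (K * t ^ β) ^ p := by
    intro s t ht ht1 hs
    have h1 : ∑ n ∈ s, y n ^ p = ∑ n ∈ s.filter (· < N), v n ^ p := by
      rw [Finset.sum_filter]
      refine Finset.sum_congr rfl fun n _ => ?_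
      simp only [hydef]
      split_ifs with h
      · rfl
      · exact Real.zero_rpow hppos.ne'
    rw [h1]
    refine hvlen _ (fun n hn => Finset.mem_range.2 (Finset.mem_filter.1 hn).2) t ht ht1 ?_
    intro n hn
    have h2 := Finset.mem_filter.1 hn
    have h3 := hs n h2.1
    simpa [hxdef, h2.2] using h3
  obtain ⟨σ, hσN, hσ⟩ := exists_perm_antitone N hx0 hxN
  have hσrange : ∀ m, N ≤ m → ∀ f : ℕ → ℝ, ∑ i ∈ Finset.range m, f (σ i)
      = ∑ i ∈ Finset.range m, f i := by
    intro m hm f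
    refine Equiv.Perm.sum_comp σ _ f fun i hi => ?_
    by_contra h
    exact hi (hσN i (hm.trans (by simpa using h)))
  have hNM : N ≤ 2 ^ N - 1 := by have := Nat.lt_two_pow_self (n := N); omega
  -- the total length
  have hxsum : ∀ m, ∑ i ∈ Finset.range m, x (σ i) ≤ 1 := by
    intro m
    have h1 : ∑ i ∈ Finset.range m, x (σ i) ≤ ∑ i ∈ Finset.range (max m N), x (σ i) :=
      Finset.sum_le_sum_of_subset_of_nonneg (Finset.range_mono (le_max_left _ _))
        fun i _ _ => hx0 _
    have h2 : ∑ i ∈ Finset.range (max m N), x i = ∑ i ∈ Finset.range N, x i := by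
      refine (Finset.sum_subset (Finset.range_mono (le_max_right _ _)) fun i _ hi => ?_).symm
      exact hxN i (by simpa using hi)
    have h3 : ∑ i ∈ Finset.range N, x i = ∑ i ∈ Finset.range N, len i :=
      Finset.sum_congr rfl fun i hi => by simp [hxdef, Finset.mem_range.1 hi]
    rw [hσrange _ (le_max_right _ _), h2, h3] at h1
    exact h1.trans hlen1
  have hx1 : ∀ i, x (σ i) ≤ 1 := fun i => (Finset.single_le_sum (fun j _ => hx0 (σ j))
    (Finset.self_mem_range_succ i)).trans (hxsum (i + 1))
  have hcond : ∑ k ∈ Finset.range N, (2 : ℝ) ^ k * x (σ (2 ^ k - 1)) ≤ 3 := by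
    have h := Finset.sum_condensed_le (f := fun j => x (σ (j - 1)))
      (fun m n _ hmn => hσ (Nat.sub_le_sub_right hmn 1)) N
    simp only [nsmul_eq_mul, Nat.cast_pow, Nat.cast_ofNat] at h
    have h2 : ∑ k ∈ Finset.Ico 2 (2 ^ N + 1), x (σ (k - 1)) ≤ 1 := by
      rw [Finset.sum_Ico_eq_sum_range]
      refine le_trans ?_ (hxsum (2 ^ N + 1 - 2 + 1))
      rw [Finset.sum_range_succ']
      have : ∑ k ∈ Finset.range (2 ^ N + 1 - 2), x (σ (2 + k - 1))
          = ∑ k ∈ Finset.range (2 ^ N + 1 - 2), x (σ (k + 1)) :=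
        Finset.sum_congr rfl fun k _ => by congr 2; omega
      rw [this]
      linarith [hx0 (σ 0)]
    rw [Finset.sum_range_succ] at h
    have h3 : 0 ≤ (2 : ℝ) ^ N * x (σ (2 ^ N - 1)) := mul_nonneg (by positivity) (hx0 _)
    have h4 := hx1 (1 - 1)
    linarith
  -- rearrange the sum and split it into dyadic blocks
  have hstart : ∑ n ∈ Finset.range N, v n * w n
      ≤ ∑ i ∈ Finset.range (2 ^ N - 1), y (σ i) * w (σ i) := by
    rw [hσrange _ hNM fun i => y i * w i]
    calc ∑ n ∈ Finset.range N, v n * w n = ∑ n ∈ Finset.range N, y n * w n :=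
          Finset.sum_congr rfl fun i hi => by simp [hydef, Finset.mem_range.1 hi]
      _ ≤ _ := Finset.sum_le_sum_of_subset_of_nonneg (Finset.range_mono hNM)
          fun i _ _ => mul_nonneg (hy0 i) (hw0 i)
  refine hstart.trans ?_
  rw [sum_range_two_pow_sub_one]
  set t : ℕ → ℝ := fun k => x (σ (2 ^ k - 1)) with ht
  set e : ℕ → ℝ := fun k =>
    (2 : ℝ) ^ (-(k * β)) * (∑ i ∈ Finset.range (2 ^ k), w i ^ p') ^ (1 / p') with he
  have he0 : ∀ k, 0 ≤ e k := fun k => by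
    have : 0 ≤ ∑ i ∈ Finset.range (2 ^ k), w i ^ p' :=
      Finset.sum_nonneg fun i _ => Real.rpow_nonneg (hw0 i) _
    simp only [he]; positivity
  have hblock : ∀ k, ∑ i ∈ Finset.range (2 ^ k), y (σ (2 ^ k - 1 + i)) * w (σ (2 ^ k - 1 + i))
      ≤ K * ((2 : ℝ) ^ k * t k + e k ^ q) := by
    intro k
    set s : Finset ℕ := (Finset.range (2 ^ k)).map
      ⟨fun i => σ (2 ^ k - 1 + i), fun i j h => by simpa using σ.injective h⟩ with hs
    have hsc : s.card = 2 ^ k := by simp [hs]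
    have hsum : ∑ i ∈ Finset.range (2 ^ k), y (σ (2 ^ k - 1 + i)) * w (σ (2 ^ k - 1 + i))
        = ∑ n ∈ s, y n * w n := by
      rw [hs, Finset.sum_map]; rfl
    have ht0 : 0 ≤ t k := hx0 _
    have h1 : ∑ n ∈ s, y n ^ p ≤ (K * t k ^ β) ^ p := by
      refine hxy s (t k) ht0 (hx1 _) fun n hn => ?_
      obtain ⟨i, -, rfl⟩ := Finset.mem_map.1 hn
      exact hσ (Nat.le_add_right _ _)
    have h2 : ∑ n ∈ s, w n ^ p' ≤ ∑ i ∈ Finset.range (2 ^ k), w i ^ p' := by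
      have := sum_le_sum_range_card_of_antitone (w := fun i => w i ^ p')
        (fun i j hij => Real.rpow_le_rpow (hw0 j) (hw hij) hp'pos.le) s
      rwa [hsc] at this
    rw [hsum]
    have h3 := Real.inner_le_Lp_mul_Lq_of_nonneg s hpp (fun i _ => hy0 i) (fun i _ => hw0 i)
    have h4 : (∑ n ∈ s, y n ^ p) ^ (1 / p) ≤ K * t k ^ β := by
      have h := Real.rpow_le_rpow (Finset.sum_nonneg fun i _ => Real.rpow_nonneg (hy0 i) _) h1
        (one_div_nonneg.2 hppos.le)
      rwa [← Real.rpow_mul (by positivity), mul_one_div_cancel hppos.ne', Real.rpow_one] at h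
    have h5 : (∑ n ∈ s, w n ^ p') ^ (1 / p') ≤ (2 : ℝ) ^ (k * β) * e k := by
      have h := Real.rpow_le_rpow (Finset.sum_nonneg fun i _ => Real.rpow_nonneg (hw0 i) _) h2
        (one_div_nonneg.2 hp'pos.le)
      refine h.trans (le_of_eq ?_)
      simp only [he]
      rw [← mul_assoc, ← Real.rpow_add two_pos]
      simp
    have h6 : (K * t k ^ β) * ((2 : ℝ) ^ (k * β) * e k) = K * (((2 : ℝ) ^ k * t k) ^ β * e k) := by
      rw [Real.mul_rpow (by positivity) ht0, ← Real.rpow_natCast, ← Real.rpow_mul two_pos.le]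
      ring
    -- Young's inequality with the exponents `1 / β` and `q`
    have h7 : ((2 : ℝ) ^ k * t k) ^ β * e k ≤ (2 : ℝ) ^ k * t k + e k ^ q := by
      have hu : 0 ≤ (2 : ℝ) ^ k * t k := by positivity
      have hq1 : 1 < q := by rw [hq, lt_div_iff₀ (by linarith)]; linarith
      have hconj : (1 / β).HolderConjugate q := by
        rw [Real.holderConjugate_iff]
        refine ⟨by rw [lt_div_iff₀ hβ0]; linarith, ?_⟩
        rw [hq]; simp
      have hY := Real.young_inequality_of_nonneg (Real.rpow_nonneg hu β) (he0 k) hconj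
      rw [← Real.rpow_mul hu, mul_one_div_cancel hβ0.ne', Real.rpow_one] at hY
      refine hY.trans (add_le_add ?_ ?_)
      · exact div_le_self hu (by rw [le_div_iff₀ hβ0]; linarith)
      · exact div_le_self (Real.rpow_nonneg (he0 k) _) hq1.le
    calc ∑ n ∈ s, y n * w n ≤ _ := h3
      _ ≤ (K * t k ^ β) * ((2 : ℝ) ^ (k * β) * e k) := by
          refine mul_le_mul h4 h5 ?_ (by positivity)
          exact Real.rpow_nonneg (Finset.sum_nonneg fun i _ => Real.rpow_nonneg (hw0 i) _) _
      _ = _ := h6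
      _ ≤ _ := mul_le_mul_of_nonneg_left h7 hK
  calc _ ≤ ∑ k ∈ Finset.range N, K * ((2 : ℝ) ^ k * t k + e k ^ q) :=
        Finset.sum_le_sum fun k _ => hblock k
    _ = K * (∑ k ∈ Finset.range N, (2 : ℝ) ^ k * t k + ∑ k ∈ Finset.range N, e k ^ q) := by
        rw [← Finset.mul_sum, Finset.sum_add_distrib]
    _ ≤ K * (3 + R) := by
        gcongr
        exact hR N

/-! ### Steklov means and the increments of a function over intervals -/

/-- The Steklov mean `h⁻¹ ∫ f` over `[x, x + h]`. -/
noncomputable def steklovMean (f : ℝ → ℝ) (h x : ℝ) : ℝ := h⁻¹ * ∫ t in x..(x + h), f t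

/-- The `L^p` mean, normalized by the step `h`, of the increment `f (x + h) - f x` over the set
`S`. -/
noncomputable def shiftMean (p : ℝ) (f : ℝ → ℝ) (h : ℝ) (S : Set ℝ) : ℝ≥0∞ :=
  ((ENNReal.ofReal h)⁻¹ * ∫⁻ x in S, ‖f (x + h) - f x‖ₑ ^ p) ^ (1 / p)

/-- The bound `‖f (· + h) - f‖_p ≤ C h ^ α` over every period, for all `h ∈ [0, 1]`. -/
def HasLpModulus (p α C : ℝ) (f : ℝ → ℝ) : Prop :=
  ∀ h, 0 ≤ h → h ≤ 1 → ∀ x₀ : ℝ,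
    ∫⁻ x in Ioc x₀ (x₀ + 1), ‖f (x + h) - f x‖ₑ ^ p ≤ ENNReal.ofReal ((C * h ^ α) ^ p)

theorem shiftMean_mono {p : ℝ} (hp : 0 < p) (f : ℝ → ℝ) (h : ℝ) {S T : Set ℝ} (hST : S ⊆ T) :
    shiftMean p f h S ≤ shiftMean p f h T := by
  unfold shiftMean
  gcongr

/-- Jensen's inequality for the mean over an interval no longer than the normalizing length. -/
theorem enorm_inv_mul_integral_le {p : ℝ} (hp : 1 < p) {φ : ℝ → ℝ} {a b h : ℝ} (hh : 0 < h)
    (hab : a ≤ b) (hbh : b - a ≤ h) (hφ : IntervalIntegrable φ volume a b) :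
    ‖h⁻¹ * ∫ x in a..b, φ x‖ₑ
      ≤ ((ENNReal.ofReal h)⁻¹ * ∫⁻ x in Ioc a b, ‖φ x‖ₑ ^ p) ^ (1 / p) := by
  have hp0 : 0 < p := by linarith
  have hpq := Real.HolderConjugate.conjExponent hp
  set q := p.conjExponent
  have hH0 : ENNReal.ofReal h ≠ 0 := by simpa using hh
  have hHt : ENNReal.ofReal h ≠ ∞ := ENNReal.ofReal_ne_top
  rw [enorm_mul, enorm_inv hh.ne', Real.enorm_eq_ofReal hh.le,
    intervalIntegral.integral_of_le hab]
  have hmeas : AEMeasurable (fun x => ‖φ x‖ₑ) (volume.restrict (Ioc a b)) :=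
    ((intervalIntegrable_iff_integrableOn_Ioc_of_le hab).1 hφ).1.enorm
  have h1 := ENNReal.lintegral_mul_le_Lp_mul_Lq (volume.restrict (Ioc a b)) hpq hmeas
    (aemeasurable_const (b := (1 : ℝ≥0∞)))
  simp only [Pi.mul_apply, mul_one, ENNReal.one_rpow, lintegral_const, one_mul,
    Measure.restrict_apply MeasurableSet.univ, univ_inter, Real.volume_Ioc] at h1
  set J := ∫⁻ x in Ioc a b, ‖φ x‖ₑ ^ p
  have h2 : ENNReal.ofReal (b - a) ^ (1 / q) ≤ ENNReal.ofReal h ^ (1 / q) :=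
    ENNReal.rpow_le_rpow (ENNReal.ofReal_le_ofReal hbh) (one_div_nonneg.2 hpq.symm.nonneg)
  have h3 : (ENNReal.ofReal h)⁻¹ * ENNReal.ofReal h ^ (1 / q)
      = ((ENNReal.ofReal h)⁻¹) ^ (1 / p) := by
    rw [← ENNReal.rpow_neg_one, ← ENNReal.rpow_add _ _ hH0 hHt, ← ENNReal.rpow_mul]
    congr 1
    have := hpq.inv_add_inv_eq_one
    simp only [one_div]
    linarith
  calc (ENNReal.ofReal h)⁻¹ * ‖∫ x in Ioc a b, φ x‖ₑ
      ≤ (ENNReal.ofReal h)⁻¹ * ∫⁻ x in Ioc a b, ‖φ x‖ₑ := by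
        gcongr; exact enorm_integral_le_lintegral_enorm _
    _ ≤ (ENNReal.ofReal h)⁻¹ * (J ^ (1 / p) * ENNReal.ofReal h ^ (1 / q)) := by
        gcongr; exact h1.trans (by gcongr)
    _ = ((ENNReal.ofReal h)⁻¹ * ENNReal.ofReal h ^ (1 / q)) * J ^ (1 / p) := by ring
    _ = _ := by
        rw [h3, ENNReal.mul_rpow_of_nonneg _ _ (by positivity)]

theorem intervalIntegrable_shift {f : ℝ → ℝ} (hf : ∀ a b, IntervalIntegrable f volume a b)
    (h a b : ℝ) :
    IntervalIntegrable (fun x => f (x + h) - f x) volume a b := by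
  refine IntervalIntegrable.sub ?_ (hf a b)
  have := (hf (a + h) (b + h)).comp_add_right h
  simpa using this

/-- Translating a Steklov mean of step `h` amounts to integrating the increment of step `h`. -/
theorem steklovMean_sub {f : ℝ → ℝ} (hf : ∀ a b, IntervalIntegrable f volume a b)
    (h x y : ℝ) :
    steklovMean f h y - steklovMean f h x = h⁻¹ * ∫ t in x..y, (f (t + h) - f t) := by
  have h1 : ∫ t in x..y, f (t + h) = ∫ t in (x + h)..(y + h), f t :=
    intervalIntegral.integral_comp_add_right f h
  have h2 : IntervalIntegrable (fun t => f (t + h)) volume x y := by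
    simpa using (hf (x + h) (y + h)).comp_add_right h
  rw [intervalIntegral.integral_sub h2 (hf _ _), h1, steklovMean, steklovMean, ← mul_sub]
  congr 1
  have e1 := intervalIntegral.integral_add_adjacent_intervals (hf x (x + h)) (hf (x + h) (y + h))
  have e2 := intervalIntegral.integral_add_adjacent_intervals (hf x y) (hf y (y + h))
  linarith

theorem steklovMean_two_mul {f : ℝ → ℝ} (hf : ∀ a b, IntervalIntegrable f volume a b)
    (h x : ℝ) :
    steklovMean f (2 * h) x = (steklovMean f h x + steklovMean f h (x + h)) / 2 := by
  have e1 := intervalIntegral.integral_add_adjacent_intervals (hf x (x + h))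
    (hf (x + h) (x + h + h))
  simp only [steklovMean]
  rw [show x + 2 * h = x + h + h by ring, ← e1, mul_inv]
  ring

theorem enorm_steklovMean_sub_le {f : ℝ → ℝ} (hf : ∀ a b, IntervalIntegrable f volume a b)
    {p : ℝ} (hp : 1 < p) {h x y : ℝ} (hh : 0 < h) (hxy : x ≤ y) (hyx : y - x ≤ h) :
    ‖steklovMean f h y - steklovMean f h x‖ₑ ≤ shiftMean p f h (Ioc x y) := by
  rw [steklovMean_sub hf]
  exact enorm_inv_mul_integral_le hp hh hxy hyx (intervalIntegrable_shift hf _ _ _)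

theorem enorm_steklovMean_halve_left_le {f : ℝ → ℝ} (hf : ∀ a b, IntervalIntegrable f volume a b)
    {p : ℝ} (hp : 1 < p) {h x : ℝ} (hh : 0 < h) :
    ‖steklovMean f h x - steklovMean f (2 * h) x‖ₑ ≤ shiftMean p f h (Ioc x (x + h)) := by
  refine le_trans ?_ (enorm_steklovMean_sub_le hf hp hh (x := x) (y := x + h) (by linarith)
    (by linarith))
  rw [steklovMean_two_mul hf, enorm_le_iff_norm_le, Real.norm_eq_abs, Real.norm_eq_abs,
    show steklovMean f h x - (steklovMean f h x + steklovMean f h (x + h)) / 2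
      = -((steklovMean f h (x + h) - steklovMean f h x) / 2) by ring, abs_neg, abs_div]
  exact div_le_self (abs_nonneg _) (by norm_num)

theorem enorm_steklovMean_halve_right_le {f : ℝ → ℝ} (hf : ∀ a b, IntervalIntegrable f volume a b)
    {p : ℝ} (hp : 1 < p) {h x : ℝ} (hh : 0 < h) :
    ‖steklovMean f h (x + h) - steklovMean f (2 * h) x‖ₑ ≤ shiftMean p f h (Ioc x (x + h)) := by
  refine le_trans ?_ (enorm_steklovMean_sub_le hf hp hh (x := x) (y := x + h) (by linarith)
    (by linarith))
  rw [steklovMean_two_mul hf, enorm_le_iff_norm_le, Real.norm_eq_abs, Real.norm_eq_abs,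
    show steklovMean f h (x + h) - (steklovMean f h x + steklovMean f h (x + h)) / 2
      = (steklovMean f h (x + h) - steklovMean f h x) / 2 by ring, abs_div]
  exact div_le_self (abs_nonneg _) (by norm_num)

/-- Difference of the means over the right and left end pieces of length `h / 2 ^ i` of an interval
`(a, b]` whose length is between `h` and `2 h`. Only the increments over `(a, b]` itself enter, and
only with the steps `h / 2 ^ j`, which do not depend on the interval. -/
theorem enorm_end_means_sub_le {f : ℝ → ℝ} (hf : ∀ a b, IntervalIntegrable f volume a b)
    {p : ℝ} (hp : 1 < p) {a b h : ℝ} (hh : 0 < h) (h1 : h ≤ b - a) (h2 : b - a ≤ 2 * h)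
    (i : ℕ) :
    ‖steklovMean f (h / 2 ^ i) (b - h / 2 ^ i) - steklovMean f (h / 2 ^ i) a‖ₑ
      ≤ ∑ j ∈ Finset.range (i + 1), 2 * shiftMean p f (h / 2 ^ j) (Ioc a b) := by
  have hp0 : 0 < p := by linarith
  induction i with
  | zero =>
    simp only [pow_zero, div_one, zero_add, Finset.range_one, Finset.sum_singleton]
    refine (enorm_steklovMean_sub_le hf hp hh (by linarith) (by linarith)).trans ?_
    refine (shiftMean_mono hp0 f h (Ioc_subset_Ioc_right (by linarith : b - h ≤ b))).trans ?_
    exact le_mul_of_one_le_left' (by norm_num)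
  | succ i ih =>
    set k := h / 2 ^ (i + 1) with hk
    have hk0 : 0 < k := by positivity
    have hki : h / 2 ^ i = 2 * k := by rw [hk, pow_succ]; field_simp
    have hle : 2 * k ≤ h := by
      rw [← hki]; exact div_le_self hh.le (one_le_pow₀ (by norm_num))
    rw [hki] at ih
    have hl := (enorm_steklovMean_halve_left_le hf hp (x := a) hk0).trans
      (shiftMean_mono hp0 f k (Ioc_subset_Ioc_right (by linarith : a + k ≤ b)))
    have hr := (enorm_steklovMean_halve_right_le hf hp (x := b - 2 * k) hk0).trans
      (shiftMean_mono hp0 f k (Ioc_subset_Ioc (by linarith : a ≤ b - 2 * k)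
        (by linarith : b - 2 * k + k ≤ b)))
    rw [show b - 2 * k + k = b - k by ring] at hr
    rw [Finset.sum_range_succ, ← hk, two_mul (shiftMean p f k (Ioc a b))]
    have hid : steklovMean f k (b - k) - steklovMean f k a
        = (steklovMean f (2 * k) (b - 2 * k) - steklovMean f (2 * k) a)
          + ((steklovMean f k (b - k) - steklovMean f (2 * k) (b - 2 * k))
          - (steklovMean f k a - steklovMean f (2 * k) a)) := by ring
    rw [hid]
    exact (enorm_add_le _ _).trans
      (add_le_add ih ((enorm_sub_le).trans (add_le_add hr hl)))

theorem tendsto_steklovMean {f : ℝ → ℝ} (hf : ∀ a b, IntervalIntegrable f volume a b)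
    {x : ℝ}
    (hx : HasDerivAt (fun y => ∫ t in (0 : ℝ)..y, f t) (f x) x) {h : ℕ → ℝ}
    (hh : ∀ i, 0 < h i) (hlim : Tendsto h atTop (𝓝 0)) :
    Tendsto (fun i => steklovMean f (h i) x) atTop (𝓝 (f x)) ∧
      Tendsto (fun i => steklovMean f (h i) (x - h i)) atTop (𝓝 (f x)) := by
  rw [hasDerivAt_iff_tendsto_slope_zero] at hx
  have hd : ∀ u v, ∫ t in u..v, f t = (∫ t in (0 : ℝ)..v, f t) - ∫ t in (0 : ℝ)..u, f t :=
    fun u v => (intervalIntegral.integral_interval_sub_left (hf _ _) (hf _ _)).symm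
  constructor
  · have h1 : Tendsto h atTop (𝓝[≠] 0) :=
      tendsto_nhdsWithin_iff.2 ⟨hlim, Eventually.of_forall fun i => (hh i).ne'⟩
    refine (hx.comp h1).congr fun i => ?_
    simp [steklovMean, hd x]
  · have h1 : Tendsto (fun i => - h i) atTop (𝓝[≠] 0) :=
      tendsto_nhdsWithin_iff.2 ⟨by simpa using hlim.neg,
        Eventually.of_forall fun i => neg_ne_zero.2 (hh i).ne'⟩
    refine (hx.comp h1).congr fun i => ?_
    simp only [Function.comp, smul_eq_mul, steklovMean, sub_add_cancel, hd (x - h i)]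
    rw [inv_neg, ← sub_eq_add_neg]
    ring

theorem tendsto_div_two_pow (h : ℝ) : Tendsto (fun i : ℕ => h / 2 ^ i) atTop (𝓝 0) := by
  have := (tendsto_pow_atTop_nhds_zero_of_lt_one (r := (1 / 2 : ℝ)) (by norm_num)
    (by norm_num)).const_mul h
  simpa [div_eq_mul_inv] using this

theorem shiftMean_period_le {p α C : ℝ} (hp : 1 < p) (hC : 0 ≤ C) {f : ℝ → ℝ}
    (hmod : HasLpModulus p α C f) {h : ℝ} (hh : 0 < h) (hh1 : h ≤ 1) (x₀ : ℝ) :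
    shiftMean p f h (Ioc x₀ (x₀ + 1)) ≤ ENNReal.ofReal (C * h ^ (α - 1 / p)) := by
  have hp0 : 0 < p := by linarith
  unfold shiftMean
  calc _ ≤ ((ENNReal.ofReal h)⁻¹ * ENNReal.ofReal ((C * h ^ α) ^ p)) ^ (1 / p) := by
        gcongr; exact hmod h hh.le hh1 x₀
    _ = ENNReal.ofReal (C * h ^ (α - 1 / p)) := by
        rw [← ENNReal.ofReal_inv_of_pos hh, ← ENNReal.ofReal_mul (by positivity),
          ENNReal.ofReal_rpow_of_nonneg (by positivity) (by positivity),
          Real.mul_rpow (by positivity) (by positivity), ← Real.rpow_mul (by positivity),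
          mul_one_div_cancel hp0.ne', Real.rpow_one, Real.rpow_sub hh, Real.inv_rpow hh.le]
        congr 1
        field_simp

/-- Minkowski's inequality for a finite sum of sequences. -/
theorem ennreal_Lp_sum_le {ι κ : Type*} (s : Finset ι) (J : Finset κ) (F : κ → ι → ℝ≥0∞) {p : ℝ}
    (hp : 1 ≤ p) :
    (∑ n ∈ s, (∑ j ∈ J, F j n) ^ p) ^ (1 / p) ≤ ∑ j ∈ J, (∑ n ∈ s, F j n ^ p) ^ (1 / p) := by
  classical
  have hp0 : 0 < p := by linarith
  induction J using Finset.induction_on with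
  | empty => simp [ENNReal.zero_rpow_of_pos, hp0]
  | insert j J hj ih =>
    simp only [Finset.sum_insert hj]
    exact (ENNReal.Lp_add_le s _ _ hp).trans (add_le_add le_rfl ih)

theorem IsNonoverlappingSeq.disjoint_Ioc {a b : ℕ → ℝ} (hab : IsNonoverlappingSeq a b) {m n : ℕ}
    (hmn : m ≠ n) : Disjoint (Ioc (a m) (b m)) (Ioc (a n) (b n)) := by
  have := hab.disjoint m n hmn
  rw [Ioo_disjoint_Ioo] at this
  rwa [Ioc_disjoint_Ioc]

/-- The normalized energies of `f (x + h) - f x` over nonoverlapping intervals add up to at most the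
energy over a period containing them. -/
theorem sum_shiftMean_rpow_le {p : ℝ} (hp : 1 < p) {f : ℝ → ℝ} {a b : ℕ → ℝ}
    (hab : IsNonoverlappingSeq a b) {x₀ : ℝ} (hx₀ : ∀ n, x₀ ≤ a n ∧ b n ≤ x₀ + 1) (h : ℝ)
    (s : Finset ℕ) :
    (∑ n ∈ s, shiftMean p f h (Ioc (a n) (b n)) ^ p) ^ (1 / p)
      ≤ shiftMean p f h (Ioc x₀ (x₀ + 1)) := by
  have hp0 : 0 < p := by linarith
  unfold shiftMean
  refine ENNReal.rpow_le_rpow ?_ (by positivity)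
  simp only [← ENNReal.rpow_mul, one_div_mul_cancel hp0.ne', ENNReal.rpow_one]
  rw [← Finset.mul_sum, ← lintegral_biUnion_finset (fun m _ n _ hmn => hab.disjoint_Ioc hmn)
    (fun n _ => measurableSet_Ioc)]
  gcongr
  exact iUnion₂_subset fun n _ => Ioc_subset_Ioc (hx₀ n).1 (hx₀ n).2

/-- Increments of a continuous function with small `L^p` modulus over nonoverlapping intervals of
comparable lengths. -/
theorem sum_abs_rpow_le_of_comparable {p α C : ℝ} (hp : 1 < p) (hα : 1 / p < α) (hC : 0 ≤ C)
    {g : ℝ → ℝ} (hg : Continuous g) (hmod : HasLpModulus p α C g) {a b : ℕ → ℝ}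
    (hab : IsNonoverlappingSeq a b) {h : ℝ} (hh : 0 < h) (hh1 : h ≤ 1) (s : Finset ℕ)
    (hs : ∀ n ∈ s, h ≤ b n - a n ∧ b n - a n ≤ 2 * h) :
    ∑ n ∈ s, |g (b n) - g (a n)| ^ p
      ≤ (2 * C / (1 - (1 / 2) ^ (α - 1 / p)) * h ^ (α - 1 / p)) ^ p := by
  have hp0 : 0 < p := by linarith
  set β := α - 1 / p with hβ
  have hβ0 : 0 < β := by linarith
  set ρ : ℝ := (1 / 2) ^ β with hρ
  have hρ0 : 0 < ρ := by positivity
  have hρ1 : ρ < 1 := Real.rpow_lt_one (by norm_num) (by norm_num) hβ0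
  have hgi : ∀ a b, IntervalIntegrable g volume a b := fun a b => hg.intervalIntegrable a b
  obtain ⟨x₀, hx₀⟩ := hab.period
  set D : ℝ := 2 * C / (1 - ρ) * h ^ β with hD
  have h1ρ : 0 < 1 - ρ := by linarith
  have hD0 : 0 ≤ D := by positivity
  set U : ℕ → ℕ → ℝ := fun i n =>
    steklovMean g (h / 2 ^ i) (b n - h / 2 ^ i) - steklovMean g (h / 2 ^ i) (a n) with hU
  have hterm : ∀ j : ℕ, (∑ n ∈ s, (2 * shiftMean p g (h / 2 ^ j) (Ioc (a n) (b n))) ^ p) ^ (1 / p)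
      ≤ ENNReal.ofReal (2 * C * h ^ β * ρ ^ j) := by
    intro j
    have hj1 : h / 2 ^ j ≤ 1 := (div_le_self hh.le (one_le_pow₀ (by norm_num))).trans hh1
    have e1 := (sum_shiftMean_rpow_le hp (f := g) hab hx₀ (h / 2 ^ j) s).trans
      (shiftMean_period_le hp hC hmod (by positivity : 0 < h / 2 ^ j) hj1 x₀)
    simp only [ENNReal.mul_rpow_of_nonneg _ _ hp0.le]
    rw [← Finset.mul_sum, ENNReal.mul_rpow_of_nonneg _ _ (by positivity), ← ENNReal.rpow_mul,
      mul_one_div_cancel hp0.ne', ENNReal.rpow_one]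
    have e2 : 2 * C * h ^ β * ρ ^ j = 2 * (C * (h / 2 ^ j) ^ β) := by
      have : ρ ^ j = ((2 : ℝ) ^ j) ^ (-β) := by
        rw [hρ, ← Real.rpow_natCast, ← Real.rpow_mul (by norm_num), mul_comm, one_div,
          Real.inv_rpow (by norm_num), ← Real.rpow_natCast, ← Real.rpow_mul (by norm_num),
          ← Real.rpow_neg (by norm_num)]
        ring_nf
      rw [Real.div_rpow hh.le (by positivity), this, Real.rpow_neg (by positivity)]
      field_simp
    rw [e2, ENNReal.ofReal_mul (by norm_num)]
    simpa only [ENNReal.ofReal_ofNat] using mul_le_mul_right e1 2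
  have hUi : ∀ i, ∑ n ∈ s, |U i n| ^ p ≤ D ^ p := by
    intro i
    have e1 : (∑ n ∈ s, ‖U i n‖ₑ ^ p) ^ (1 / p) ≤ ENNReal.ofReal D := by
      calc (∑ n ∈ s, ‖U i n‖ₑ ^ p) ^ (1 / p)
          ≤ (∑ n ∈ s, (∑ j ∈ Finset.range (i + 1),
              2 * shiftMean p g (h / 2 ^ j) (Ioc (a n) (b n))) ^ p) ^ (1 / p) := by
            gcongr with n hn
            exact enorm_end_means_sub_le hgi hp hh (hs n hn).1 (hs n hn).2 i
        _ ≤ _ := ennreal_Lp_sum_le s _ _ hp.le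
        _ ≤ ∑ j ∈ Finset.range (i + 1), ENNReal.ofReal (2 * C * h ^ β * ρ ^ j) :=
            Finset.sum_le_sum fun j _ => hterm j
        _ ≤ ENNReal.ofReal D := by
            rw [← ENNReal.ofReal_sum_of_nonneg fun j _ => by positivity, ← Finset.mul_sum]
            refine ENNReal.ofReal_le_ofReal ?_
            have hgeo : ∑ j ∈ Finset.range (i + 1), ρ ^ j ≤ (1 - ρ)⁻¹ := by
              rw [← tsum_geometric_of_lt_one hρ0.le hρ1]
              exact (summable_geometric_of_lt_one hρ0.le hρ1).sum_le_tsum _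
                fun j _ => by positivity
            calc 2 * C * h ^ β * ∑ j ∈ Finset.range (i + 1), ρ ^ j
                ≤ 2 * C * h ^ β * (1 - ρ)⁻¹ := by gcongr
              _ = D := by rw [hD]; field_simp
    have e2 := ENNReal.rpow_le_rpow e1 hp0.le
    rw [← ENNReal.rpow_mul, one_div_mul_cancel hp0.ne', ENNReal.rpow_one,
      ENNReal.ofReal_rpow_of_nonneg hD0 hp0.le] at e2
    have e3 : ∑ n ∈ s, ‖U i n‖ₑ ^ p = ENNReal.ofReal (∑ n ∈ s, |U i n| ^ p) := by
      rw [ENNReal.ofReal_sum_of_nonneg fun n _ => by positivity]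
      refine Finset.sum_congr rfl fun n _ => ?_
      rw [← ofReal_norm, ENNReal.ofReal_rpow_of_nonneg (norm_nonneg _) hp0.le, Real.norm_eq_abs]
    rw [e3] at e2
    exact (ENNReal.ofReal_le_ofReal_iff (by positivity)).1 e2
  have hlim : Tendsto (fun i => ∑ n ∈ s, |U i n| ^ p) atTop
      (𝓝 (∑ n ∈ s, |g (b n) - g (a n)| ^ p)) := by
    refine tendsto_finsetSum _ fun n _ => ?_
    have hder : ∀ x, HasDerivAt (fun y => ∫ t in (0 : ℝ)..y, g t) (g x) x := fun x =>
      intervalIntegral.integral_hasDerivAt_right (hgi _ _)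
        hg.stronglyMeasurable.stronglyMeasurableAtFilter hg.continuousAt
    have hpos : ∀ i : ℕ, 0 < h / 2 ^ i := fun i => by positivity
    have t1 := (tendsto_steklovMean hgi (hder (b n)) hpos (tendsto_div_two_pow h)).2
    have t2 := (tendsto_steklovMean hgi (hder (a n)) hpos (tendsto_div_two_pow h)).1
    exact (t1.sub t2).abs.rpow_const (Or.inr hp0.le)
  exact le_of_tendsto' hlim hUi

/-- Increments of a continuous function with small `L^p` modulus over nonoverlapping intervals of
length at most `t`. -/
theorem exists_sum_abs_rpow_le {p α C : ℝ} (hp : 1 < p) (hα : 1 / p < α) (hC : 0 ≤ C)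
    {g : ℝ → ℝ} (hg : Continuous g) (hmod : HasLpModulus p α C g) :
    ∃ K, 0 ≤ K ∧ ∀ a b : ℕ → ℝ, IsNonoverlappingSeq a b → ∀ s : Finset ℕ, ∀ t, 0 ≤ t → t ≤ 1 →
      (∀ n ∈ s, b n - a n ≤ t) →
      ∑ n ∈ s, |g (b n) - g (a n)| ^ p ≤ (K * t ^ (α - 1 / p)) ^ p := by
  have hp0 : 0 < p := by linarith
  set β := α - 1 / p with hβ
  have hβ0 : 0 < β := by linarith
  set D : ℝ := 2 * C / (1 - (1 / 2) ^ β) with hD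
  have h1 : (1 / 2 : ℝ) ^ β < 1 := Real.rpow_lt_one (by norm_num) (by norm_num) hβ0
  have hD0 : 0 ≤ D := div_nonneg (by positivity) (by linarith)
  set σ : ℝ := (1 / 2) ^ (β * p) with hσ
  have hσ0 : 0 < σ := by positivity
  have hσ1 : σ < 1 := Real.rpow_lt_one (by norm_num) (by norm_num) (by positivity)
  have h1σ : 0 < 1 - σ := by linarith
  refine ⟨D / (1 - σ) ^ (1 / p), by positivity, fun a b hab s t ht ht1 hs => ?_⟩
  rcases ht.eq_or_lt with rfl | ht0
  · have : ∀ n ∈ s, |g (b n) - g (a n)| ^ p = 0 := fun n hn => by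
      have : b n = a n := le_antisymm (by linarith [hs n hn]) (hab.le n)
      rw [this, sub_self, abs_zero, Real.zero_rpow hp0.ne']
    rw [Finset.sum_eq_zero this]
    positivity
  -- Intervals of positive length fall into finitely many classes of comparable lengths.
  have key : ∀ M : ℕ, ∀ s : Finset ℕ, ∀ t, 0 < t → t ≤ 1 →
      (∀ n ∈ s, t / 2 ^ M < b n - a n ∧ b n - a n ≤ t) →
      (1 - σ) * ∑ n ∈ s, |g (b n) - g (a n)| ^ p ≤ (D * t ^ β) ^ p := by
    intro M
    induction M with
    | zero =>
      intro s t ht0 _ hs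
      have : s = ∅ := Finset.eq_empty_of_forall_notMem fun n hn => by
        have := hs n hn
        simp only [pow_zero, div_one] at this
        linarith
      rw [this]
      simp only [Finset.sum_empty, mul_zero]
      positivity
    | succ M ih =>
      intro s t ht0 ht1 hs
      have hlong := sum_abs_rpow_le_of_comparable hp hα hC hg hmod hab (h := t / 2) (by positivity)
        (by linarith) (s.filter fun n => t / 2 < b n - a n) (fun n hn => by
          have e1 := Finset.mem_filter.1 hn
          exact ⟨e1.2.le, by linarith [(hs n e1.1).2]⟩)
      have hshort := ih (s.filter fun n => ¬ t / 2 < b n - a n) (t / 2) (by positivity)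
        (by linarith) (fun n hn => by
          have e1 := Finset.mem_filter.1 hn
          refine ⟨?_, not_lt.1 e1.2⟩
          have e2 := (hs n e1.1).1
          rwa [pow_succ', ← div_div] at e2)
      have hlong' : (D * (t / 2) ^ β) ^ p ≤ (D * t ^ β) ^ p := by
        gcongr
        linarith
      have hscale : (D * (t / 2) ^ β) ^ p = σ * (D * t ^ β) ^ p := by
        rw [div_eq_mul_one_div, Real.mul_rpow ht0.le (by norm_num), ← mul_assoc,
          Real.mul_rpow (by positivity) (by positivity), ← Real.rpow_mul (by norm_num), ← hσ]
        ring
      rw [← Finset.sum_filter_add_sum_filter_not s (fun n => t / 2 < b n - a n), mul_add]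
      have e3 := mul_le_mul_of_nonneg_left (hlong.trans hlong') h1σ.le
      have e4 := hshort.trans_eq hscale
      linarith
  have hpos : ∃ M : ℕ, ∀ n ∈ s.filter (fun n => a n < b n), t / 2 ^ M < b n - a n := by
    have : ∀ᶠ M : ℕ in atTop, ∀ n ∈ s.filter (fun n => a n < b n), t / 2 ^ M < b n - a n := by
      rw [Filter.eventually_all_finset]
      intro n hn
      exact (tendsto_div_two_pow t).eventually
        (gt_mem_nhds (sub_pos.2 (Finset.mem_filter.1 hn).2))
    exact this.exists
  obtain ⟨M, hM⟩ := hpos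
  have e1 := key M (s.filter fun n => a n < b n) t ht0 ht1
    (fun n hn => ⟨hM n hn, hs n (Finset.mem_filter.1 hn).1⟩)
  have e2 : ∑ n ∈ s.filter (fun n => a n < b n), |g (b n) - g (a n)| ^ p
      = ∑ n ∈ s, |g (b n) - g (a n)| ^ p := by
    refine Finset.sum_filter_of_ne fun n _ hne => ?_
    refine lt_of_le_of_ne (hab.le n) fun heq => hne ?_
    rw [heq, sub_self, abs_zero, Real.zero_rpow hp0.ne']
  rw [e2] at e1
  rw [div_mul_eq_mul_div, Real.div_rpow (by positivity) (by positivity),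
    ← Real.rpow_mul h1σ.le, one_div_mul_cancel hp0.ne', Real.rpow_one, le_div_iff₀ h1σ]
  linarith

/-! ### The continuous representative -/

theorem lintegral_Ioc_eq_of_periodic {F : ℝ → ℝ≥0∞} (hF : Function.Periodic F 1) (x₀ : ℝ) :
    ∫⁻ x in Ioc x₀ (x₀ + 1), F x = ∫⁻ x in Icc (0 : ℝ) 1, F x := by
  have h := (isAddFundamentalDomain_Ioc one_pos x₀ volume).setLIntegral_eq
    (isAddFundamentalDomain_Ioc one_pos 0 volume) F hF.map_vadd_zmultiples
  rw [h, zero_add]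
  exact (setLIntegral_congr Ioc_ae_eq_Icc)

theorem LipClass.intervalIntegrable {α p : ℝ} (hp : 1 < p) {f : ℝ → ℝ} (hf : f ∈ LipClass α p)
    (a b : ℝ) : IntervalIntegrable f volume a b := by
  obtain ⟨hper, hmem, -⟩ := hf
  refine hper.intervalIntegrable₀ one_ne_zero ?_ a b
  rw [intervalIntegrable_iff_integrableOn_Icc_of_le zero_le_one]
  exact hmem.integrable (by simpa using ENNReal.ofReal_le_ofReal hp.le)

theorem LipClass.exists_hasLpModulus {α p : ℝ} (hp : 1 < p) {f : ℝ → ℝ} (hf : f ∈ LipClass α p) :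
    ∃ C, 0 ≤ C ∧ HasLpModulus p α C f := by
  obtain ⟨hper, hmem, C, hC⟩ := hf
  have hp0 : 0 < p := by linarith
  refine ⟨C, C.2, fun h hh hh1 x₀ => ?_⟩
  have hF : Function.Periodic (fun x => ‖f (x + h) - f x‖ₑ ^ p) 1 := fun x => by
    have : x + 1 + h = x + h + 1 := by ring
    simp only [this, hper _]
  rw [lintegral_Ioc_eq_of_periodic hF]
  have h1 : eLpNorm (fun x => f (x + h) - f x) (ENNReal.ofReal p) (volume.restrict (Icc 0 1))
      ≤ C * ENNReal.ofReal (h ^ α) :=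
    le_trans (le_iSup₂ (f := fun h' (_ : h' ∈ Icc (0 : ℝ) h) =>
      eLpNorm (fun x => f (x + h') - f x) (ENNReal.ofReal p) (volume.restrict (Icc 0 1))) h
      ⟨hh, le_rfl⟩) (hC h ⟨hh, hh1⟩)
  rw [eLpNorm_eq_lintegral_rpow_enorm_toReal (by simpa using hp0) ENNReal.ofReal_ne_top,
    ENNReal.toReal_ofReal hp0.le] at h1
  have h2 := ENNReal.rpow_le_rpow h1 hp0.le
  rw [← ENNReal.rpow_mul, one_div_mul_cancel hp0.ne', ENNReal.rpow_one] at h2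
  refine h2.trans_eq ?_
  rw [← ENNReal.ofReal_coe_nnreal, ← ENNReal.ofReal_mul (NNReal.coe_nonneg C),
    ENNReal.ofReal_rpow_of_nonneg (by positivity) hp0.le]

/-- Every function with `L^p` modulus `O(h ^ α)`, `α > 1 / p`, agrees almost everywhere with a
continuous periodic function: the uniform limit of its Steklov means of step `2 ^ (-i)`. -/
theorem exists_continuous_ae_eq {p α C : ℝ} (hp : 1 < p) (hα : 1 / p < α) (hC : 0 ≤ C)
    {f : ℝ → ℝ} (hper : Function.Periodic f 1) (hf : ∀ a b, IntervalIntegrable f volume a b)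
    (hmod : HasLpModulus p α C f) :
    ∃ g : ℝ → ℝ, Continuous g ∧ g =ᵐ[volume] f ∧ Function.Periodic g 1 ∧ HasLpModulus p α C g := by
  have hp0 : 0 < p := by linarith
  set ρ : ℝ := (1 / 2) ^ (α - 1 / p) with hρ
  have hρ0 : 0 < ρ := by positivity
  have hρ1 : ρ < 1 := Real.rpow_lt_one (by norm_num) (by norm_num) (by linarith)
  set A : ℕ → ℝ → ℝ := fun i x => steklovMean f (1 / 2 ^ i) x with hA
  -- `shiftMean` over a whole period is `O(h ^ (α - 1 / p))`, so consecutive means are close.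
  have hstep : ∀ x i, dist (A i x) (A (i + 1) x) ≤ C * ρ * ρ ^ i := by
    intro x i
    set h : ℝ := 1 / 2 ^ (i + 1) with hh
    have hh0 : 0 < h := by positivity
    have hh1 : h ≤ 1 := div_le_self zero_le_one (one_le_pow₀ (by norm_num))
    have h2 : (1 : ℝ) / 2 ^ i = 2 * h := by rw [hh, pow_succ]; field_simp
    have e1 := ((enorm_steklovMean_halve_left_le hf hp (x := x) hh0).trans
      (shiftMean_mono hp0 f h (Ioc_subset_Ioc_right (by linarith : x + h ≤ x + 1)))).trans
      (shiftMean_period_le hp hC hmod hh0 hh1 x)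
    rw [dist_comm, Real.dist_eq, ← Real.norm_eq_abs]
    simp only [hA]
    rw [h2, ← hh]
    rw [← ofReal_norm, ENNReal.ofReal_le_ofReal_iff (by positivity)] at e1
    refine e1.trans (le_of_eq ?_)
    rw [mul_assoc, ← pow_succ', hρ, hh, Real.rpow_pow_comm (by norm_num), one_div_pow]
  have hcau : ∀ x, ∃ y, Tendsto (fun i => A i x) atTop (𝓝 y) := fun x =>
    cauchySeq_tendsto_of_complete (cauchySeq_of_le_geometric ρ (C * ρ) hρ1 (hstep x))
  choose g hg using hcau
  have hunif : TendstoUniformly A g atTop := by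
    rw [Metric.tendstoUniformly_iff]
    intro ε hε
    have : Tendsto (fun i : ℕ => C * ρ * ρ ^ i / (1 - ρ)) atTop (𝓝 0) := by
      have := ((tendsto_pow_atTop_nhds_zero_of_lt_one hρ0.le hρ1).const_mul (C * ρ)).div_const
        (1 - ρ)
      simpa using this
    filter_upwards [this.eventually (gt_mem_nhds hε)] with i hi x
    rw [dist_comm]
    exact (dist_le_of_le_geometric_of_tendsto ρ (C * ρ) hρ1 (hstep x) (hg x) i).trans_lt hi
  have hAc : ∀ i, Continuous (A i) := by
    intro i
    have hF := intervalIntegral.continuous_primitive hf 0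
    have : A i = fun x => (1 / 2 ^ i : ℝ)⁻¹ *
        ((∫ t in (0 : ℝ)..(x + 1 / 2 ^ i), f t) - ∫ t in (0 : ℝ)..x, f t) := by
      funext x
      simp only [hA, steklovMean]
      rw [intervalIntegral.integral_interval_sub_left (hf _ _) (hf _ _)]
    rw [this]
    exact continuous_const.mul ((hF.comp (continuous_id.add continuous_const)).sub hF)
  have hgc : Continuous g := hunif.continuous (Frequently.of_forall hAc)
  have hgf : g =ᵐ[volume] f := by
    have hloc : LocallyIntegrable f volume := fun x =>
      ⟨Icc (x - 1) (x + 1), Icc_mem_nhds (by linarith) (by linarith),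
        (intervalIntegrable_iff_integrableOn_Icc_of_le (by linarith)).1 (hf _ _)⟩
    filter_upwards [_root_.LocallyIntegrable.ae_hasDerivAt_integral hloc] with x hx
    exact tendsto_nhds_unique (hg x)
      (tendsto_steklovMean hf (hx 0) (fun i => by positivity) (tendsto_div_two_pow 1)).1
  refine ⟨g, hgc, hgf, fun x => ?_, fun h hh hh1 x₀ => ?_⟩
  · refine tendsto_nhds_unique (hg (x + 1)) ((hg x).congr fun i => ?_)
    simp only [hA, steklovMean]
    have := intervalIntegral.integral_comp_add_right f (a := x) (b := x + 1 / 2 ^ i) 1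
    simp only [hper _] at this
    rw [this]
    ring_nf
  · have hshift : ∀ᵐ x, g (x + h) = f (x + h) :=
      (measurePreserving_add_right volume h).quasiMeasurePreserving.ae hgf
    have : ∫⁻ x in Ioc x₀ (x₀ + 1), ‖g (x + h) - g x‖ₑ ^ p
        = ∫⁻ x in Ioc x₀ (x₀ + 1), ‖f (x + h) - f x‖ₑ ^ p := by
      refine lintegral_congr_ae (ae_restrict_of_ae ?_)
      filter_upwards [hshift, hgf] with x h1 h2
      rw [h1, h2]
    rw [this]
    exact hmod h hh hh1 x₀

/-! ### Sufficiency of the block condition -/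

/-- The sequence `2 ^ (n (1 - α)) / l (2 ^ n)` governing the embedding: the block condition of the
theorem says that it belongs to `ℓ^r'`. -/
noncomputable def dyadicRatio (α : ℝ) (l : ℕ → ℝ) (n : ℕ) : ℝ :=
  (2 : ℝ) ^ ((n : ℝ) * (1 - α)) / l (2 ^ n)

theorem dyadicRatio_pos {α : ℝ} {l : ℕ → ℝ} (hl : IsLambdaSeq l) (n : ℕ) :
    0 < dyadicRatio α l n :=
  div_pos (by positivity) (hl.pos _ Nat.one_le_two_pow)

/-- The first term of the `n`-th block sum, times the number `2 ^ n` of terms, is the `p'`-th power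
of the dyadic ratio, since `1 / p' - (α - 1 / p) = 1 - α`. -/
theorem dyadicRatio_rpow {p α p' : ℝ} (hpp : p.HolderConjugate p') {l : ℕ → ℝ}
    (hl : IsLambdaSeq l) (n : ℕ) :
    (2 : ℝ) ^ n * (1 / (((2 : ℝ) ^ n) ^ (α - 1 / p) * l (2 ^ n))) ^ p'
      = dyadicRatio α l n ^ p' := by
  have hl0 := hl.pos (2 ^ n) Nat.one_le_two_pow
  have hp' := hpp.symm.pos
  have h1 : (2 : ℝ) ^ n = ((2 : ℝ) ^ ((n : ℝ) / p')) ^ p' := by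
    rw [← Real.rpow_mul (by norm_num), div_mul_cancel₀ _ hp'.ne', Real.rpow_natCast]
  have h2 : (n : ℝ) * (1 - α) = (n : ℝ) / p' - n * (α - 1 / p) := by
    have := hpp.inv_add_inv_eq_one
    simp only [div_eq_mul_inv, one_mul]
    linear_combination (-(n : ℝ)) * this
  calc _ = ((2 : ℝ) ^ ((n : ℝ) / p')) ^ p'
        * (1 / (((2 : ℝ) ^ n) ^ (α - 1 / p) * l (2 ^ n))) ^ p' := by rw [← h1]
    _ = _ := by
        rw [← Real.mul_rpow (by positivity) (by positivity), dyadicRatio, h2,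
          Real.rpow_sub two_pos, Real.rpow_mul two_pos.le, Real.rpow_natCast]
        congr 1
        field_simp

/-- By monotonicity of `l`, the block sums of the theorem may be replaced by single terms. -/
theorem summable_blocks_iff {p α p' q : ℝ} (hpp : p.HolderConjugate p') (hα : 1 / p < α)
    (hq : 0 < q) {l : ℕ → ℝ} (hl : IsLambdaSeq l) :
    Summable (fun n : ℕ => (∑ k ∈ Finset.Icc ((2 : ℕ) ^ n) ((2 : ℕ) ^ (n + 1)),
      (1 / ((k : ℝ) ^ (α - 1 / p) * l k)) ^ p') ^ (q / p')) ↔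
    Summable (fun n : ℕ => dyadicRatio α l n ^ q) := by
  have hp' := hpp.symm.pos
  have hβ : 0 < α - 1 / p := by linarith
  have hqp : 0 < q / p' := by positivity
  set F : ℕ → ℝ := fun k => (1 / ((k : ℝ) ^ (α - 1 / p) * l k)) ^ p' with hF
  have hF0 : ∀ k, 1 ≤ k → 0 ≤ F k := fun k hk => by
    have := hl.pos k hk
    simp only [hF]; positivity
  have hanti : ∀ j k, 1 ≤ j → j ≤ k → F k ≤ F j := fun j k hj hjk => by
    have h1 := hl.pos j hj
    have h2 := hl.pos k (hj.trans hjk)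
    have h3 := hl.mono j k hj hjk
    have h4 : (0 : ℝ) < j := by exact_mod_cast hj
    have h5 : (j : ℝ) ≤ k := by exact_mod_cast hjk
    simp only [hF]
    gcongr
  have hcard : ∀ n : ℕ, (Finset.Icc ((2 : ℕ) ^ n) ((2 : ℕ) ^ (n + 1))).card = 2 ^ n + 1 := by
    intro n
    have := Nat.one_le_two_pow (n := n)
    rw [Nat.card_Icc, pow_succ]; omega
  have hval : ∀ n : ℕ, (2 : ℝ) ^ n * F (2 ^ n) = dyadicRatio α l n ^ p' := fun n => by
    rw [← dyadicRatio_rpow hpp hl n]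
    simp [hF]
  have hpow : ∀ n, (dyadicRatio α l n ^ p') ^ (q / p') = dyadicRatio α l n ^ q := fun n => by
    rw [← Real.rpow_mul (dyadicRatio_pos hl n).le, mul_div_cancel₀ _ hp'.ne']
  have hnn : ∀ n : ℕ, 0 ≤ ∑ k ∈ Finset.Icc ((2 : ℕ) ^ n) ((2 : ℕ) ^ (n + 1)), F k := fun n =>
    Finset.sum_nonneg fun k hk => hF0 k (Nat.one_le_two_pow.trans (Finset.mem_Icc.1 hk).1)
  have hupper : ∀ n : ℕ, ∑ k ∈ Finset.Icc ((2 : ℕ) ^ n) ((2 : ℕ) ^ (n + 1)), F k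
      ≤ 2 * dyadicRatio α l n ^ p' := by
    intro n
    have h := Finset.sum_le_card_nsmul (Finset.Icc ((2 : ℕ) ^ n) ((2 : ℕ) ^ (n + 1))) F (F (2 ^ n))
      fun k hk => hanti _ _ Nat.one_le_two_pow (Finset.mem_Icc.1 hk).1
    rw [hcard, nsmul_eq_mul] at h
    refine h.trans ?_
    rw [← hval n]
    have h1 : (1 : ℝ) ≤ 2 ^ n := one_le_pow₀ (by norm_num)
    have h2 := hF0 (2 ^ n) Nat.one_le_two_pow
    push_cast
    nlinarith
  have hlower : ∀ n : ℕ, dyadicRatio α l (n + 1) ^ p'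
      ≤ 2 * ∑ k ∈ Finset.Icc ((2 : ℕ) ^ n) ((2 : ℕ) ^ (n + 1)), F k := by
    intro n
    have h := Finset.card_nsmul_le_sum (Finset.Icc ((2 : ℕ) ^ n) ((2 : ℕ) ^ (n + 1))) F
      (F (2 ^ (n + 1))) fun k hk => hanti _ _
        (Nat.one_le_two_pow.trans (Finset.mem_Icc.1 hk).1) (Finset.mem_Icc.1 hk).2
    rw [hcard, nsmul_eq_mul] at h
    rw [← hval (n + 1), pow_succ]
    have h2 := hF0 (2 ^ (n + 1)) Nat.one_le_two_pow
    push_cast at h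
    linarith
  constructor
  · intro hs
    rw [← summable_nat_add_iff 1]
    refine Summable.of_nonneg_of_le (fun n => Real.rpow_nonneg (dyadicRatio_pos hl _).le _)
      (fun n => ?_) (hs.mul_left ((2 : ℝ) ^ (q / p')))
    rw [← hpow, ← Real.mul_rpow (by norm_num) (hnn n)]
    exact Real.rpow_le_rpow (Real.rpow_nonneg (dyadicRatio_pos hl _).le _) (hlower n) hqp.le
  · intro hs
    refine Summable.of_nonneg_of_le (fun n => Real.rpow_nonneg (hnn n) _)
      (fun n => ?_) (hs.mul_left ((2 : ℝ) ^ (q / p')))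
    rw [← hpow, ← Real.mul_rpow (by norm_num) (Real.rpow_nonneg (dyadicRatio_pos hl _).le _)]
    exact Real.rpow_le_rpow (hnn n) (hupper n) hqp.le

theorem IsNonoverlappingSeq.sum_length_le {a b : ℕ → ℝ} (hab : IsNonoverlappingSeq a b)
    (s : Finset ℕ) : ∑ n ∈ s, (b n - a n) ≤ 1 := by
  obtain ⟨x₀, hx₀⟩ := hab.period
  have h1 : volume (⋃ n ∈ s, Ioc (a n) (b n)) ≤ volume (Ioc x₀ (x₀ + 1)) :=
    measure_mono (iUnion₂_subset fun n _ => Ioc_subset_Ioc (hx₀ n).1 (hx₀ n).2)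
  rw [measure_biUnion_finset (fun m _ n _ hmn => hab.disjoint_Ioc hmn)
    fun n _ => measurableSet_Ioc] at h1
  simp only [Real.volume_Ioc, add_sub_cancel_left] at h1
  rw [← ENNReal.ofReal_sum_of_nonneg fun n _ => sub_nonneg.2 (hab.le n)] at h1
  exact (ENNReal.ofReal_le_ofReal_iff zero_le_one).1 h1

/-- If `dyadicRatio α l` is in `ℓ^q` then the normalized `ℓ^p'` norms of the first `2 ^ k` weights
`1 / l` form an `ℓ^q` sequence. -/
theorem exists_sum_weights_le {p α p' q : ℝ} (hpp : p.HolderConjugate p') (hα : 1 / p < α)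
    (hq : 1 ≤ q) {l : ℕ → ℝ} (hl : IsLambdaSeq l)
    (hsum : Summable fun n => dyadicRatio α l n ^ q) :
    ∃ R, ∀ M, ∑ k ∈ Finset.range M, ((2 : ℝ) ^ (-(k * (α - 1 / p))) *
      (∑ i ∈ Finset.range (2 ^ k), (1 / l (i + 1)) ^ p') ^ (1 / p')) ^ q ≤ R := by
  have hp' := hpp.symm.pos
  have hβ : 0 < α - 1 / p := by linarith
  have hl0 : ∀ n, 0 < l (n + 1) := fun n => hl.pos _ (by omega)
  have hS0 : ∀ k : ℕ, 0 ≤ ∑ i ∈ Finset.range (2 ^ k), (1 / l (i + 1)) ^ p' := fun k =>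
    Finset.sum_nonneg fun i _ => by have := hl0 i; positivity
  refine sum_rpow_le_of_recursion (θ := (2 : ℝ) ^ (-(α - 1 / p))) (by positivity)
    (Real.rpow_lt_one_of_one_lt_of_neg (by norm_num) (by linarith)) hq
    (fun k => mul_nonneg (by positivity) (Real.rpow_nonneg (hS0 k) _))
    (fun k => (dyadicRatio_pos hl k).le) (fun k => ?_) hsum
  have hlk := hl.pos (2 ^ k) Nat.one_le_two_pow
  have hblock : ∑ i ∈ Finset.range (2 ^ k), (1 / l (2 ^ k + i + 1)) ^ p'
      ≤ 2 ^ k * (1 / l (2 ^ k)) ^ p' := by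
    have h := Finset.sum_le_card_nsmul (Finset.range (2 ^ k))
      (fun i => (1 / l (2 ^ k + i + 1)) ^ p') ((1 / l (2 ^ k)) ^ p') fun i _ => by
        have h1 := hl.mono (2 ^ k) (2 ^ k + i + 1) Nat.one_le_two_pow (by omega)
        have h2 := hl0 (2 ^ k + i)
        gcongr
    simpa [nsmul_eq_mul] using h
  have hsplit : (∑ i ∈ Finset.range (2 ^ (k + 1)), (1 / l (i + 1)) ^ p') ^ (1 / p')
      ≤ (∑ i ∈ Finset.range (2 ^ k), (1 / l (i + 1)) ^ p') ^ (1 / p')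
        + (2 ^ k * (1 / l (2 ^ k)) ^ p') ^ (1 / p') := by
    rw [pow_succ, mul_two, Finset.sum_range_add]
    refine le_trans (Real.rpow_le_rpow ?_ (add_le_add le_rfl hblock) (by positivity))
      (Real.rpow_add_le_add_rpow (hS0 k) (by positivity) (by positivity) ?_)
    · exact add_nonneg (hS0 k) (Finset.sum_nonneg fun i _ => by
        have := hl0 (2 ^ k + i); positivity)
    · rw [div_le_one hp']; exact hpp.symm.lt.le
  have hlast : (2 : ℝ) ^ (-(k * (α - 1 / p))) * (2 ^ k * (1 / l (2 ^ k)) ^ p') ^ (1 / p')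
      = dyadicRatio α l k := by
    have h1 := dyadicRatio_rpow (α := α) hpp hl k
    have h2 : (((2 : ℝ) ^ (-(k * (α - 1 / p)))) ^ p') ^ (1 / p')
        = (2 : ℝ) ^ (-(k * (α - 1 / p))) := by
      rw [← Real.rpow_mul (by positivity), mul_one_div_cancel hp'.ne', Real.rpow_one]
    have h3 : (dyadicRatio α l k ^ p') ^ (1 / p') = dyadicRatio α l k := by
      rw [← Real.rpow_mul (dyadicRatio_pos hl k).le, mul_one_div_cancel hp'.ne', Real.rpow_one]
    rw [← h3, ← h1, ← h2, ← Real.mul_rpow (by positivity) (by positivity)]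
    congr 1
    rw [mul_left_comm, ← Real.mul_rpow (by positivity) (by positivity), Real.rpow_neg two_pos.le,
      Real.rpow_mul two_pos.le, Real.rpow_natCast]
    congr 2
    field_simp
  have hθ : (2 : ℝ) ^ (-(((k + 1 : ℕ) : ℝ) * (α - 1 / p)))
      = (2 : ℝ) ^ (-(α - 1 / p)) * (2 : ℝ) ^ (-(k * (α - 1 / p))) := by
    rw [← Real.rpow_add two_pos]; push_cast; ring_nf
  rw [hθ, mul_assoc]
  refine mul_le_mul_of_nonneg_left ?_ (by positivity)
  rw [← hlast, ← mul_add]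
  exact mul_le_mul_of_nonneg_left hsplit (by positivity)

theorem lipSubsetLambdaBV_of_summable {p α p' q : ℝ} (hpp : p.HolderConjugate p')
    (hα : 1 / p < α) (hα1 : α < 1) (hq : q = 1 / (1 + 1 / p - α)) {l : ℕ → ℝ}
    (hl : IsLambdaSeq l) (hsum : Summable fun n => dyadicRatio α l n ^ q) :
    LipSubsetLambdaBV α p l := by
  intro f hf
  have hp := hpp.lt
  have hp0 := hpp.pos
  have h1p : 0 < 1 / p := by positivity
  obtain ⟨C, hC, hmod⟩ := LipClass.exists_hasLpModulus hp hf
  obtain ⟨g, hgc, hgf, hgper, hgmod⟩ := exists_continuous_ae_eq hp hα hC hf.1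
    (LipClass.intervalIntegrable hp hf) hmod
  refine ⟨g, hgc, hgf, hgper, ?_⟩
  obtain ⟨K, hK, hKb⟩ := exists_sum_abs_rpow_le hp hα hC hgc hgmod
  have hq1 : 1 ≤ q := by rw [hq, le_div_iff₀ (by linarith)]; linarith
  obtain ⟨R, hR⟩ := exists_sum_weights_le hpp hα hq1 hl hsum
  have hl0 : ∀ n, 0 < l (n + 1) := fun n => hl.pos _ (by omega)
  have hbound : lambdaVariation l g ≤ ENNReal.ofReal (K * (3 + R)) := by
    refine iSup_le fun a => iSup_le fun b => iSup_le fun hab => ?_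
    refine ENNReal.tsum_le_of_sum_range_le fun N => ?_
    rw [← ENNReal.ofReal_sum_of_nonneg fun n _ => div_nonneg (abs_nonneg _) (hl0 n).le]
    refine ENNReal.ofReal_le_ofReal ?_
    simp only [div_eq_mul_one_div (|_|)]
    refine sum_mul_le_of_length_bound (len := fun n => b n - a n)
      (v := fun n => |g (b n) - g (a n)|) (w := fun n => 1 / l (n + 1)) (q := q)
      hpp (β := α - 1 / p) (by linarith) (by linarith) (by rw [hq]; ring_nf) hK N
      (fun n => abs_nonneg _) (fun n => sub_nonneg.2 (hab.le n)) (hab.sum_length_le _)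
      (fun n => (one_div_pos.2 (hl0 n)).le) (fun m n hmn => ?_)
      (fun s _ t ht ht1 hs => hKb a b hab s t ht ht1 hs) hR
    exact one_div_le_one_div_of_le (hl0 m) (hl.mono _ _ (by omega) (by omega))
  exact hbound.trans_lt ENNReal.ofReal_lt_top

/-! ### Sums of disjoint periodic tents -/

/-- The `1`-periodic tent of height `A` supported on the translates of an interval of length `d`
with center `c`; the distance to `c + ℤ` is the norm on the circle. -/
noncomputable def periodicTent (c d A x : ℝ) : ℝ :=
  max 0 (A * (1 - 2 * ‖((x - c : ℝ) : UnitAddCircle)‖ / d))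

theorem le_norm_coe_unitAddCircle {s t : ℝ} (h1 : s ≤ t) (h2 : t ≤ 1 - s) :
    s ≤ ‖(t : UnitAddCircle)‖ := by
  rw [UnitAddCircle.norm_eq]
  rcases le_or_gt (round t) 0 with h | h
  · have : (round t : ℝ) ≤ 0 := by exact_mod_cast h
    exact le_trans (by linarith) (le_abs_self _)
  · have : (1 : ℝ) ≤ round t := by exact_mod_cast h
    exact le_trans (by linarith) (neg_le_abs _)

theorem norm_coe_unitAddCircle_le (t : ℝ) : ‖(t : UnitAddCircle)‖ ≤ |t| := by
  rw [UnitAddCircle.norm_eq]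
  simpa using round_le t 0

theorem coe_unitAddCircle_add_one (t : ℝ) : ((t + 1 : ℝ) : UnitAddCircle) = t :=
  AddCircle.coe_add_period 1 t

theorem periodicTent_nonneg (c d A x : ℝ) : 0 ≤ periodicTent c d A x := le_max_left _ _

theorem periodicTent_le {c d A : ℝ} (hd : 0 < d) (hA : 0 ≤ A) (x : ℝ) :
    periodicTent c d A x ≤ A := by
  refine max_le hA (mul_le_of_le_one_right hA ?_)
  have : 0 ≤ 2 * ‖((x - c : ℝ) : UnitAddCircle)‖ / d := by positivity
  linarith

theorem periodicTent_eq_zero {c d A x : ℝ} (hd : 0 < d) (hA : 0 ≤ A)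
    (hx : d / 2 ≤ ‖((x - c : ℝ) : UnitAddCircle)‖) : periodicTent c d A x = 0 := by
  refine max_eq_left (mul_nonpos_of_nonneg_of_nonpos hA ?_)
  have : 1 ≤ 2 * ‖((x - c : ℝ) : UnitAddCircle)‖ / d := by rw [le_div_iff₀ hd]; linarith
  linarith

theorem periodicTent_center {c d A : ℝ} (hA : 0 ≤ A) : periodicTent c d A c = A := by
  simp [periodicTent, hA]

theorem periodicTent_sub_le {c d A : ℝ} (hd : 0 < d) (hA : 0 ≤ A) (x y : ℝ) :
    periodicTent c d A x - periodicTent c d A y ≤ A * min 1 (2 * |x - y| / d) := by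
  rw [mul_min_of_nonneg _ _ hA, mul_one]
  refine le_min (by linarith [periodicTent_le hd hA x (c := c), periodicTent_nonneg c d A y]) ?_
  have h1 : ‖((y - c : ℝ) : UnitAddCircle)‖ - ‖((x - c : ℝ) : UnitAddCircle)‖ ≤ |x - y| := by
    refine (norm_sub_norm_le _ _).trans ?_
    rw [← AddCircle.coe_sub, show y - c - (x - c) = y - x by ring, abs_sub_comm]
    exact norm_coe_unitAddCircle_le _
  have h2 : 0 ≤ A * (2 * |x - y| / d) := by positivity
  have h3 : A * (1 - 2 * ‖((x - c : ℝ) : UnitAddCircle)‖ / d)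
      ≤ A * (1 - 2 * ‖((y - c : ℝ) : UnitAddCircle)‖ / d) + A * (2 * |x - y| / d) := by
    rw [← mul_add]
    refine mul_le_mul_of_nonneg_left ?_ hA
    rw [sub_add_eq_add_sub, add_sub_assoc, ← sub_div]
    have : -(2 * ‖((x - c : ℝ) : UnitAddCircle)‖ / d)
      ≤ (2 * |x - y| - 2 * ‖((y - c : ℝ) : UnitAddCircle)‖) / d := by
      rw [← neg_div]; gcongr; linarith
    linarith
  unfold periodicTent
  rw [sub_le_iff_le_add]
  refine max_le (add_nonneg h2 (le_max_left _ _)) (h3.trans ?_)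
  linarith [le_max_right 0 (A * (1 - 2 * ‖((y - c : ℝ) : UnitAddCircle)‖ / d))]

/-- The open support of the tent, over one period, has measure at most `d`. -/
theorem lintegral_indicator_tent_le (c s : ℝ) {d : ℝ} :
    ∫⁻ x in Icc (0 : ℝ) 1, {y : ℝ | ‖((y - c : ℝ) : UnitAddCircle)‖ < d / 2}.indicator
      (fun _ => (1 : ℝ≥0∞)) (x + s) ≤ ENNReal.ofReal d := by
  set T : Set ℝ := {y : ℝ | ‖((y - c : ℝ) : UnitAddCircle)‖ < d / 2} with hT
  have hper : Function.Periodic (fun x => T.indicator (fun _ => (1 : ℝ≥0∞)) (x + s)) 1 := by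
    intro x
    have : x + 1 + s ∈ T ↔ x + s ∈ T := by
      simp only [hT, mem_ofPred_eq]
      rw [show x + 1 + s - c = (x + s - c) + 1 by ring, coe_unitAddCircle_add_one]
    simp only [indicator, this]
  rw [← lintegral_Ioc_eq_of_periodic hper (c - s - 1 / 2)]
  calc _ ≤ ∫⁻ x in Ioc (c - s - 1 / 2) (c - s - 1 / 2 + 1),
        (Ioo (c - s - d / 2) (c - s + d / 2)).indicator (fun _ => (1 : ℝ≥0∞)) x := by
        refine setLIntegral_mono' measurableSet_Ioc fun x hx => ?_
        by_cases hxT : x + s ∈ T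
        · have h1 : |x + s - c| ≤ |(1 : ℝ)| / 2 := by
            rw [abs_one, abs_le]; constructor <;> linarith [hx.1, hx.2]
          have h2 := hxT
          simp only [hT, mem_ofPred_eq] at h2
          rw [(AddCircle.norm_coe_eq_abs_iff 1 one_ne_zero).2 h1, abs_lt] at h2
          rw [indicator_of_mem hxT, indicator_of_mem]
          constructor <;> linarith [h2.1, h2.2]
        · rw [indicator_of_notMem hxT]; exact zero_le
    _ ≤ ∫⁻ x, (Ioo (c - s - d / 2) (c - s + d / 2)).indicator (fun _ => (1 : ℝ≥0∞)) x :=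
        setLIntegral_le_lintegral _ _
    _ = ENNReal.ofReal d := by
        rw [lintegral_indicator_const measurableSet_Ioo, Real.volume_Ioo, one_mul]
        congr 1; ring

/-- A family of periodic tents with disjoint open supports. -/
structure TentFamily where
  /-- The centers. -/
  c : ℕ → ℝ
  /-- The widths. -/
  d : ℕ → ℝ
  /-- The heights. -/
  A : ℕ → ℝ
  d_pos : ∀ n, 0 < d n
  A_nonneg : ∀ n, 0 ≤ A n
  sep : ∀ m n, m ≠ n → (d m + d n) / 2 ≤ ‖((c m - c n : ℝ) : UnitAddCircle)‖

namespace TentFamily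

variable (T : TentFamily)

/-- The open support of the `n`-th tent. -/
def support (n : ℕ) : Set ℝ := {y : ℝ | ‖((y - T.c n : ℝ) : UnitAddCircle)‖ < T.d n / 2}

/-- The sum of the tents; at each point at most one term is nonzero. -/
noncomputable def sum (x : ℝ) : ℝ := ∑' n, periodicTent (T.c n) (T.d n) (T.A n) x

theorem tent_eq_zero {n : ℕ} {x : ℝ} (hx : x ∉ T.support n) :
    periodicTent (T.c n) (T.d n) (T.A n) x = 0 :=
  periodicTent_eq_zero (T.d_pos n) (T.A_nonneg n) (not_lt.1 hx)

theorem notMem_support {m n : ℕ} (hmn : m ≠ n) {x : ℝ} (hx : x ∈ T.support m) :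
    x ∉ T.support n := by
  intro hx'
  have h := T.sep m n hmn
  have h1 : ((T.c m - T.c n : ℝ) : UnitAddCircle)
      = ((x - T.c n : ℝ) : UnitAddCircle) - ((x - T.c m : ℝ) : UnitAddCircle) := by
    rw [← AddCircle.coe_sub]; congr 1; ring
  rw [h1] at h
  have h2 := norm_sub_le ((x - T.c n : ℝ) : UnitAddCircle) ((x - T.c m : ℝ) : UnitAddCircle)
  have h3 : ‖((x - T.c m : ℝ) : UnitAddCircle)‖ < T.d m / 2 := hx
  have h4 : ‖((x - T.c n : ℝ) : UnitAddCircle)‖ < T.d n / 2 := hx'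
  linarith

theorem sum_eq_of_mem {n : ℕ} {x : ℝ} (hx : x ∈ T.support n) :
    T.sum x = periodicTent (T.c n) (T.d n) (T.A n) x :=
  tsum_eq_single n fun _ hm => T.tent_eq_zero (T.notMem_support hm.symm hx)

theorem sum_eq_zero {x : ℝ} (hx : ∀ n, x ∉ T.support n) : T.sum x = 0 := by
  simp [sum, fun n => T.tent_eq_zero (hx n)]

theorem sum_nonneg (x : ℝ) : 0 ≤ T.sum x := tsum_nonneg fun _ => periodicTent_nonneg _ _ _ _

theorem tent_le_sum (n : ℕ) (x : ℝ) : periodicTent (T.c n) (T.d n) (T.A n) x ≤ T.sum x := by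
  by_cases hx : x ∈ T.support n
  · exact (T.sum_eq_of_mem hx).ge
  · rw [T.tent_eq_zero hx]; exact T.sum_nonneg x

theorem sum_periodic : Function.Periodic T.sum 1 := by
  intro x
  simp only [sum, periodicTent]
  refine tsum_congr fun n => ?_
  rw [show x + 1 - T.c n = (x - T.c n) + 1 by ring, coe_unitAddCircle_add_one]

/-- Where the sum takes different values, one tent alone accounts for the increment. -/
theorem exists_abs_sum_sub_le {x y : ℝ} (hxy : T.sum x ≠ T.sum y) :
    ∃ n, (x ∈ T.support n ∨ y ∈ T.support n) ∧
      |T.sum x - T.sum y| ≤ T.A n * min 1 (2 * |x - y| / T.d n) := by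
  have key : ∀ x y, T.sum y < T.sum x → ∃ n, x ∈ T.support n ∧
      |T.sum x - T.sum y| ≤ T.A n * min 1 (2 * |x - y| / T.d n) := by
    intro x y h
    obtain ⟨n, hn⟩ : ∃ n, x ∈ T.support n := by
      by_contra! hne
      rw [T.sum_eq_zero hne] at h
      exact absurd h (not_lt.2 (T.sum_nonneg y))
    refine ⟨n, hn, ?_⟩
    rw [abs_of_pos (sub_pos.2 h), T.sum_eq_of_mem hn]
    exact (sub_le_sub_left (T.tent_le_sum n y) _).trans
      (periodicTent_sub_le (T.d_pos n) (T.A_nonneg n) x y)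
  rcases lt_or_gt_of_ne hxy with h | h
  · obtain ⟨n, hn, hb⟩ := key y x h
    rw [abs_sub_comm, abs_sub_comm y x] at hb
    exact ⟨n, Or.inr hn, hb⟩
  · obtain ⟨n, hn, hb⟩ := key x y h
    exact ⟨n, Or.inl hn, hb⟩

theorem continuous_sum {β : ℝ} (hβ0 : 0 < β) (hβ1 : β ≤ 1) (hA : ∀ n, T.A n ≤ T.d n ^ β) :
    Continuous T.sum := by
  have hH : ∀ x y, |T.sum x - T.sum y| ≤ (2 * |x - y|) ^ β := by
    intro x y
    by_cases hxy : T.sum x = T.sum y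
    · rw [hxy, sub_self, abs_zero]; positivity
    obtain ⟨n, -, hb⟩ := T.exists_abs_sum_sub_le hxy
    refine hb.trans ?_
    have hd := T.d_pos n
    have hu : 0 ≤ 2 * |x - y| / T.d n := by positivity
    have h1 : min 1 (2 * |x - y| / T.d n) ≤ (2 * |x - y| / T.d n) ^ β := by
      rcases le_total 1 (2 * |x - y| / T.d n) with h | h
      · exact (min_le_left _ _).trans (Real.one_le_rpow h hβ0.le)
      · exact (min_le_right _ _).trans (Real.self_le_rpow_of_le_one hu h hβ1)
    calc T.A n * min 1 (2 * |x - y| / T.d n)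
        ≤ T.d n ^ β * (2 * |x - y| / T.d n) ^ β := by
          gcongr
          exact hA n
      _ = (2 * |x - y|) ^ β := by
          rw [← Real.mul_rpow hd.le hu, mul_div_cancel₀ _ hd.ne']
  rw [continuous_iff_continuousAt]
  intro x
  rw [ContinuousAt, tendsto_iff_dist_tendsto_zero]
  have hlim : Tendsto (fun y => (2 * |y - x|) ^ β) (𝓝 x) (𝓝 0) := by
    have h0 : Continuous fun y : ℝ => (2 * |y - x|) ^ β :=
      Continuous.rpow_const (by fun_prop) fun _ => Or.inr hβ0.le
    have := h0.tendsto x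
    simpa [Real.zero_rpow hβ0.ne'] using this
  exact squeeze_zero (fun _ => dist_nonneg) (fun y => by rw [Real.dist_eq]; exact hH y x) hlim

/-- The `L^p` modulus of the sum is the `ℓ^p` sum of the moduli of the tents. -/
theorem lintegral_sum_shift_le {p : ℝ} (hp : 0 < p) (h : ℝ) :
    ∫⁻ x in Icc (0 : ℝ) 1, ‖T.sum (x + h) - T.sum x‖ₑ ^ p
      ≤ 2 * ∑' n, ENNReal.ofReal ((T.A n * min 1 (2 * |h| / T.d n)) ^ p * T.d n) := by
  set B : ℕ → ℝ := fun n => T.A n * min 1 (2 * |h| / T.d n) with hB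
  have hB0 : ∀ n, 0 ≤ B n := fun n => mul_nonneg (T.A_nonneg n)
    (le_min zero_le_one (by have := T.d_pos n; positivity))
  set I : ℕ → ℝ → ℝ≥0∞ := fun n => (T.support n).indicator fun _ => 1 with hI
  have hpt : ∀ x, ‖T.sum (x + h) - T.sum x‖ₑ ^ p
      ≤ ∑' n, ENNReal.ofReal (B n ^ p) * (I n (x + h) + I n (x + 0)) := by
    intro x
    by_cases hxy : T.sum (x + h) = T.sum x
    · rw [hxy, sub_self, enorm_zero, ENNReal.zero_rpow_of_pos hp]; exact zero_le
    obtain ⟨n, hn, hb⟩ := T.exists_abs_sum_sub_le hxy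
    rw [add_sub_cancel_left] at hb
    refine le_trans ?_ (ENNReal.le_tsum n)
    have h1 : 1 ≤ I n (x + h) + I n (x + 0) := by
      rw [add_zero]
      rcases hn with hn | hn
      · exact le_add_right (by simp [hI, hn])
      · exact le_add_left (by simp [hI, hn])
    calc ‖T.sum (x + h) - T.sum x‖ₑ ^ p ≤ ENNReal.ofReal (B n ^ p) := by
          rw [← ofReal_norm, ENNReal.ofReal_rpow_of_nonneg (norm_nonneg _) hp.le]
          exact ENNReal.ofReal_le_ofReal (Real.rpow_le_rpow (norm_nonneg _) hb hp.le)
      _ ≤ _ := le_mul_of_one_le_right' h1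
  have hmeasT : ∀ n, MeasurableSet (T.support n) := fun n => by
    refine (isOpen_lt ?_ continuous_const).measurableSet
    exact continuous_norm.comp
      ((AddCircle.continuous_mk' 1).comp (continuous_id.sub continuous_const))
  have hmeas : ∀ n s, Measurable fun x => I n (x + s) := fun n s =>
    (measurable_const.indicator (hmeasT n)).comp (measurable_id.add_const s)
  calc _ ≤ ∫⁻ x in Icc (0 : ℝ) 1, ∑' n, ENNReal.ofReal (B n ^ p) * (I n (x + h) + I n (x + 0)) :=
        lintegral_mono hpt
    _ = ∑' n, ∫⁻ x in Icc (0 : ℝ) 1, ENNReal.ofReal (B n ^ p) * (I n (x + h) + I n (x + 0)) :=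
        lintegral_tsum fun n =>
          (((hmeas n h).add (hmeas n 0)).const_mul _).aemeasurable
    _ ≤ ∑' n, 2 * ENNReal.ofReal (B n ^ p * T.d n) := by
        refine ENNReal.tsum_le_tsum fun n => ?_
        have hadd : Measurable fun x => I n (x + h) + I n (x + 0) := (hmeas n h).add (hmeas n 0)
        rw [lintegral_const_mul _ hadd, lintegral_add_left (hmeas n h),
          ENNReal.ofReal_mul (Real.rpow_nonneg (hB0 n) _), mul_left_comm, two_mul]
        gcongr
        · exact lintegral_indicator_tent_le _ _
        · exact lintegral_indicator_tent_le _ _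
    _ = _ := ENNReal.tsum_mul_left

/-- A bound `O(h ^ (α p))` for the partial sums of the `p`-th powers of the moduli of the tents puts
their sum in `Lip (α; p)`. -/
theorem sum_mem_lipClass {p α E : ℝ} (hp : 0 < p) (hα : 0 < α) (hE : 0 ≤ E)
    (hcont : Continuous T.sum)
    (hbound : ∀ h, 0 < h → ∀ N, ∑ n ∈ Finset.range N,
      (T.A n * min 1 (2 * h / T.d n)) ^ p * T.d n ≤ E * h ^ (α * p)) :
    T.sum ∈ LipClass α p := by
  refine ⟨T.sum_periodic, ?_, ⟨((2 * E) ^ (1 / p)).toNNReal, fun δ hδ => ?_⟩⟩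
  · obtain ⟨C, hC⟩ := isCompact_Icc.exists_bound_of_continuousOn (s := Icc (0 : ℝ) 1)
      hcont.continuousOn
    refine MemLp.of_bound hcont.aestronglyMeasurable C ?_
    exact (ae_restrict_iff' measurableSet_Icc).2 (Eventually.of_forall hC)
  · refine iSup₂_le fun h hh => ?_
    rcases hh.1.eq_or_lt with rfl | hh0
    · simp
    have hd := T.d_pos
    have h1 : ∫⁻ x in Icc (0 : ℝ) 1, ‖T.sum (x + h) - T.sum x‖ₑ ^ p
        ≤ ENNReal.ofReal (2 * E * δ ^ (α * p)) := by
      refine (T.lintegral_sum_shift_le hp h).trans ?_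
      rw [mul_assoc, ENNReal.ofReal_mul (by norm_num), ENNReal.ofReal_ofNat]
      gcongr
      refine ENNReal.tsum_le_of_sum_range_le fun N => ?_
      rw [abs_of_pos hh0, ← ENNReal.ofReal_sum_of_nonneg fun n _ => by
        have := T.A_nonneg n; have := hd n; positivity]
      refine ENNReal.ofReal_le_ofReal ((hbound h hh0 N).trans ?_)
      have := hh.2
      gcongr
    rw [eLpNorm_eq_lintegral_rpow_enorm_toReal (by simpa using hp) ENNReal.ofReal_ne_top,
      ENNReal.toReal_ofReal hp.le]
    have hδ0 := hδ.1
    calc _ ≤ ENNReal.ofReal (2 * E * δ ^ (α * p)) ^ (1 / p) := by gcongr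
      _ = ENNReal.ofReal ((2 * E) ^ (1 / p) * δ ^ α) := by
          rw [ENNReal.ofReal_rpow_of_nonneg (by positivity) (by positivity),
            Real.mul_rpow (by positivity) (by positivity), ← Real.rpow_mul hδ0, mul_assoc,
            mul_one_div_cancel hp.ne', mul_one]
      _ = _ := by rw [ENNReal.ofReal_mul (by positivity)]; rfl

end TentFamily

/-- Packing `2 ^ k` tents of width `μ k / 2 ^ k` for each `k`, side by side, into one period. With
heights `δ ^ α μ ^ (-1 / p)` each group contributes about `h ^ α` to the `L^p` modulus at scale
`h ≈ δ`, and less at other scales; when the widths decay geometrically the sum is of class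
`Lip (α; p)`. The intervals returned join the left end of each tent to its peak. -/
theorem exists_mem_lipClass_of_widths {p α θ : ℝ} (hp : 1 < p) (hα : 1 / p < α) (hα1 : α < 1)
    (hθ0 : 0 < θ) (hθ1 : θ < 1) {μ : ℕ → ℝ} (hμ0 : ∀ k, 0 < μ k)
    (hμ1 : ∀ K, ∑ k ∈ Finset.range K, μ k ≤ 1)
    (hrec : ∀ k, μ (k + 1) / 2 ^ (k + 1) ≤ θ * (μ k / 2 ^ k)) :
    ∃ f ∈ LipClass α p, Continuous f ∧ ∃ a b : ℕ → ℝ, IsNonoverlappingSeq a b ∧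
      ∀ n, |f (b n) - f (a n)| = (μ (Nat.log 2 (n + 1)) / 2 ^ Nat.log 2 (n + 1)) ^ α *
        μ (Nat.log 2 (n + 1)) ^ (-(1 / p)) := by
  have hp0 : 0 < p := by linarith
  have h1p : 0 < 1 / p := by positivity
  have hα0 : 0 < α := by linarith
  set δ : ℕ → ℝ := fun k => μ k / 2 ^ k with hδ
  have hδ0 : ∀ k, 0 < δ k := fun k => div_pos (hμ0 k) (by positivity)
  set H : ℕ → ℝ := fun k => δ k ^ α * μ k ^ (-(1 / p)) with hH
  have hH0 : ∀ k, 0 < H k := fun k =>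
    mul_pos (Real.rpow_pos_of_pos (hδ0 k) _) (Real.rpow_pos_of_pos (hμ0 k) _)
  set d : ℕ → ℝ := fun n => δ (Nat.log 2 (n + 1)) with hd
  have hd0 : ∀ n, 0 < d n := fun n => hδ0 _
  set x : ℕ → ℝ := fun n => ∑ m ∈ Finset.range n, d m with hx
  have hxs : ∀ n, x (n + 1) = x n + d n := fun n => Finset.sum_range_succ _ _
  have hxmono : Monotone x := monotone_nat_of_le_succ fun n => by rw [hxs]; linarith [hd0 n]
  have hx0 : ∀ n, 0 ≤ x n := fun n => Finset.sum_nonneg fun m _ => (hd0 m).le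
  have hdyadic : ∀ n, n ≤ 2 ^ n - 1 := fun n => by
    have := Nat.lt_two_pow_self (n := n); omega
  have hx1 : ∀ n, x n ≤ 1 := by
    intro n
    refine (hxmono (hdyadic n)).trans ?_
    simp only [hx, hd]
    rw [sum_range_two_pow_sub_one_log δ]
    refine (le_of_eq (Finset.sum_congr rfl fun k _ => ?_)).trans (hμ1 n)
    simp only [hδ, nsmul_eq_mul, Nat.cast_pow, Nat.cast_ofNat]
    field_simp
  have hlt : ∀ m n, m < n → x m + d m ≤ x n := fun m n hmn => by
    rw [← hxs]; exact hxmono hmn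
  have hsep : ∀ m n, m < n → (d m + d n) / 2
      ≤ ‖((x n + d n / 2 - (x m + d m / 2) : ℝ) : UnitAddCircle)‖ := fun m n hmn =>
    le_norm_coe_unitAddCircle (by linarith [hlt m n hmn])
      (by linarith [hx1 (n + 1), hxs n, hx0 m])
  set T : TentFamily :=
    { c := fun n => x n + d n / 2
      d := d
      A := fun n => H (Nat.log 2 (n + 1))
      d_pos := hd0
      A_nonneg := fun n => (hH0 _).le
      sep := fun m n hmn => by
        rcases lt_or_gt_of_ne hmn with h | h
        · rw [← norm_neg, ← AddCircle.coe_neg, neg_sub]; exact hsep m n h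
        · rw [add_comm]; exact hsep n m h } with hT
  have hcont : Continuous T.sum := by
    refine T.continuous_sum (β := α - 1 / p) (by linarith) (by linarith) fun n => ?_
    change H _ ≤ δ _ ^ (α - 1 / p)
    set k := Nat.log 2 (n + 1)
    have h1 : δ k ≤ μ k := div_le_self (hμ0 k).le (one_le_pow₀ (by norm_num))
    have h2 := Real.rpow_le_rpow_of_nonpos (hδ0 k) h1 (by linarith : -(1 / p) ≤ 0)
    rw [sub_eq_add_neg, Real.rpow_add (hδ0 k)]
    exact mul_le_mul_of_nonneg_left h2 (Real.rpow_nonneg (hδ0 k).le _)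
  have hAexp : 0 < α * p := by positivity
  have hBexp : 0 < (1 - α) * p := mul_pos (by linarith) hp0
  set E : ℝ := 1 / (1 - θ ^ (α * p)) + 1 / (1 - θ ^ ((1 - α) * p)) with hE
  have hE0 : 0 ≤ E := by
    have h1 := Real.rpow_lt_one hθ0.le hθ1 hAexp
    have h2 := Real.rpow_lt_one hθ0.le hθ1 hBexp
    have h3 : 0 < 1 - θ ^ (α * p) := by linarith
    have h4 : 0 < 1 - θ ^ ((1 - α) * p) := by linarith
    positivity
  refine ⟨T.sum, T.sum_mem_lipClass hp0 hα0 (E := 2 ^ (α * p) * E) (by positivity) hcont ?_, hcont,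
    x, fun n => x n + d n / 2, ⟨fun n => by linarith [hd0 n], ⟨0, fun n => ⟨hx0 n, ?_⟩⟩, ?_⟩, ?_⟩
  · intro h hh N
    have hz : ∀ k, 0 < δ k / (2 * h) := fun k => div_pos (hδ0 k) (by positivity)
    have hsum := sum_min_rpow_le (z := fun k => δ k / (2 * h)) hθ0 hθ1 hAexp hBexp hz
      (fun k => by rw [← mul_div_assoc]; gcongr; exact hrec k) N
    have hterm : ∀ k, (2 : ℝ) ^ k * ((H k * min 1 (2 * h / δ k)) ^ p * δ k)
        ≤ (2 * h) ^ (α * p) *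
          min ((δ k / (2 * h)) ^ (α * p)) ((δ k / (2 * h)) ^ (-((1 - α) * p))) := by
      intro k
      set z := δ k / (2 * h) with hzdef
      have hz0 : 0 < z := hz k
      have hδz : δ k = 2 * h * z := by rw [hzdef]; field_simp
      have hinv : 2 * h / δ k = z⁻¹ := by rw [hzdef, inv_div]
      have hm0 : 0 ≤ min 1 z⁻¹ := le_min zero_le_one (by positivity)
      have h1 : H k ^ p = δ k ^ (α * p) * (μ k)⁻¹ := by
        simp only [hH]
        rw [Real.mul_rpow (Real.rpow_nonneg (hδ0 k).le _) (Real.rpow_nonneg (hμ0 k).le _),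
          ← Real.rpow_mul (hδ0 k).le, ← Real.rpow_mul (hμ0 k).le, neg_mul,
          one_div_mul_cancel hp0.ne', Real.rpow_neg_one]
      have h2 : (2 : ℝ) ^ k * ((μ k)⁻¹ * δ k) = 1 := by
        have := (hμ0 k).ne'
        simp only [hδ]; field_simp
      have h3 : (2 : ℝ) ^ k * ((H k * min 1 (2 * h / δ k)) ^ p * δ k)
          = (2 * h) ^ (α * p) * (z ^ (α * p) * min 1 z⁻¹ ^ p) := by
        rw [hinv, Real.mul_rpow (hH0 k).le hm0, h1]
        calc _ = δ k ^ (α * p) * min 1 z⁻¹ ^ p * ((2 : ℝ) ^ k * ((μ k)⁻¹ * δ k)) := by ring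
          _ = _ := by
            rw [h2, mul_one, hδz, Real.mul_rpow (by positivity) hz0.le]; ring
      rw [h3]
      refine mul_le_mul_of_nonneg_left (le_min ?_ ?_) (by positivity)
      · refine mul_le_of_le_one_right (by positivity) (Real.rpow_le_one hm0 (min_le_left _ _) hp0.le)
      · calc z ^ (α * p) * min 1 z⁻¹ ^ p ≤ z ^ (α * p) * z⁻¹ ^ p := by
              gcongr; exact min_le_right _ _
          _ = z ^ (-((1 - α) * p)) := by
              rw [Real.inv_rpow hz0.le, ← Real.rpow_neg hz0.le, ← Real.rpow_add hz0]
              ring_nf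
    calc ∑ n ∈ Finset.range N, (T.A n * min 1 (2 * h / T.d n)) ^ p * T.d n
        ≤ ∑ n ∈ Finset.range (2 ^ N - 1), (T.A n * min 1 (2 * h / T.d n)) ^ p * T.d n := by
          refine Finset.sum_le_sum_of_subset_of_nonneg (Finset.range_mono (hdyadic N))
            fun n _ _ => ?_
          have := T.A_nonneg n; have := T.d_pos n; positivity
      _ = ∑ k ∈ Finset.range N, (2 : ℝ) ^ k * ((H k * min 1 (2 * h / δ k)) ^ p * δ k) := by
          have := sum_range_two_pow_sub_one_log
            (fun k => (H k * min 1 (2 * h / δ k)) ^ p * δ k) N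
          simp only [nsmul_eq_mul, Nat.cast_pow, Nat.cast_ofNat] at this
          exact this
      _ ≤ (2 * h) ^ (α * p) * E := by
          refine (Finset.sum_le_sum fun k _ => hterm k).trans ?_
          rw [← Finset.mul_sum]
          gcongr
      _ = 2 ^ (α * p) * E * h ^ (α * p) := by
          rw [Real.mul_rpow (by norm_num) hh.le]; ring
  · linarith [hx1 (n + 1), hxs n, hd0 n]
  · have hdis : ∀ m n, m < n →
        Disjoint (Ioo (x m) (x m + d m / 2)) (Ioo (x n) (x n + d n / 2)) := by
      intro m n hmn
      rw [Ioo_disjoint_Ioo]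
      exact (min_le_left _ _).trans (le_trans (by linarith [hlt m n hmn, hd0 m]) (le_max_right _ _))
    intro m n hmn
    rcases lt_or_gt_of_ne hmn with h | h
    · exact hdis m n h
    · exact (hdis n m h).symm
  · intro n
    have h1 : T.sum (x n + d n / 2) = H (Nat.log 2 (n + 1)) := by
      have hmem : x n + d n / 2 ∈ T.support n := by
        change ‖((x n + d n / 2 - (x n + d n / 2) : ℝ) : UnitAddCircle)‖ < d n / 2
        have := hd0 n
        simp [this]
      rw [T.sum_eq_of_mem hmem]
      exact periodicTent_center (hH0 _).le
    have h2 : T.sum (x n) = 0 := by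
      refine T.sum_eq_zero fun m hm => ?_
      have hm' : ‖((x n - (x m + d m / 2) : ℝ) : UnitAddCircle)‖ < d m / 2 := hm
      refine absurd hm' (not_lt.2 ?_)
      rcases lt_or_ge m n with h | h
      · exact le_norm_coe_unitAddCircle (by linarith [hlt m n h]) (by linarith [hx1 n, hx0 m])
      · rw [← norm_neg, ← AddCircle.coe_neg, neg_sub]
        exact le_norm_coe_unitAddCircle (by linarith [hxmono h])
          (by linarith [hx1 (m + 1), hxs m, hx0 n])
    rw [h1, h2, sub_zero, abs_of_pos (hH0 _)]

/-! ### Necessity of the block condition -/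

theorem not_lipSubsetLambdaBV_of_not_summable {p α q : ℝ} (hp : 1 < p) (hα : 1 / p < α)
    (hα1 : α < 1) (hq : q = 1 / (1 + 1 / p - α)) {l : ℕ → ℝ} (hl : IsLambdaSeq l)
    (hsum : ¬ Summable fun n => dyadicRatio α l n ^ q) :
    ¬ LipSubsetLambdaBV α p l := by
  have hp0 : 0 < p := by linarith
  have h1p : 0 < 1 / p := by positivity
  set β := α - 1 / p with hβ
  have hβ0 : 0 < β := by linarith
  have hq' : q = 1 / (1 - β) := by rw [hq, hβ]; ring_nf
  have h1β : 0 < 1 - β := by linarith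
  have hq0 : 0 < q := by rw [hq']; positivity
  -- the ratios, with `l` evaluated at the far end of the dyadic block
  set c : ℕ → ℝ := fun k => (2 : ℝ) ^ ((k : ℝ) * (1 - α)) / l (2 ^ (k + 1)) with hc
  have hl2 : ∀ k, 0 < l (2 ^ k) := fun k => hl.pos _ Nat.one_le_two_pow
  have hc0 : ∀ k, 0 < c k := fun k => div_pos (by positivity) (hl2 _)
  set a : ℕ → ℝ := fun k => c k ^ q with ha
  have ha0 : ∀ k, 0 < a k := fun k => Real.rpow_pos_of_pos (hc0 k) _
  have hadiv : ¬ Summable a := by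
    intro h
    refine hsum ((summable_nat_add_iff 1).1 ?_)
    refine (h.mul_left (((2 : ℝ) ^ (1 - α)) ^ q)).congr fun k => ?_
    simp only [ha]
    rw [← Real.mul_rpow (by positivity) (hc0 k).le, dyadicRatio]
    simp only [hc]
    rw [← mul_div_assoc, ← Real.rpow_add two_pos]
    push_cast
    ring_nf
  set τ : ℝ := (2 : ℝ) ^ ((1 - α) * q) with hτ
  have hτ2 : τ < 2 := by
    have h1 : (1 - α) * q < 1 := by
      rw [hq', mul_one_div, div_lt_one h1β]; linarith
    calc τ < (2 : ℝ) ^ (1 : ℝ) := Real.rpow_lt_rpow_of_exponent_lt (by norm_num) h1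
      _ = 2 := Real.rpow_one 2
  have hτ0 : 0 < τ := by positivity
  have harec : ∀ k, a (k + 1) ≤ τ * a k := by
    intro k
    have h1 : c (k + 1) ≤ (2 : ℝ) ^ (1 - α) * c k := by
      simp only [hc]
      rw [← mul_div_assoc, ← Real.rpow_add two_pos]
      have h2 := hl.mono (2 ^ (k + 1)) (2 ^ (k + 1 + 1)) Nat.one_le_two_pow
        (Nat.pow_le_pow_right two_pos (by omega))
      have h3 : ((k + 1 : ℕ) : ℝ) * (1 - α) = 1 - α + (k : ℝ) * (1 - α) := by push_cast; ring
      rw [h3]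
      have := hl2 (k + 1)
      gcongr
    have h4 := Real.rpow_le_rpow (hc0 (k + 1)).le h1 hq0.le
    rwa [Real.mul_rpow (by positivity) (hc0 k).le, ← Real.rpow_mul two_pos.le] at h4
  set G : ℕ → ℝ := fun k => 1 + ∑ j ∈ Finset.range (k + 1), a j with hG
  have hG0 : ∀ k, 0 < G k := fun k => by
    have := Finset.sum_nonneg fun j (_ : j ∈ Finset.range (k + 1)) => (ha0 j).le
    simp only [hG]; linarith
  have hGrec : ∀ k, G k ≤ G (k + 1) := fun k => by
    simp only [hG]; rw [Finset.sum_range_succ _ (k + 1)]; linarith [ha0 (k + 1)]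
  -- Abel–Dini weights: `∑ w` converges while `∑ w ^ β * c = ∑ a / G` diverges. Since `G` increases
  -- and `a` grows at most by the factor `τ < 2`, the widths `w k / 2 ^ k` decay geometrically.
  set w : ℕ → ℝ := fun k => a k / G k ^ (1 / β) with hw
  have hw0 : ∀ k, 0 < w k := fun k => div_pos (ha0 k) (Real.rpow_pos_of_pos (hG0 k) _)
  have hwsum : Summable w := summable_div_partialSum_rpow ha0 (by
    rw [lt_div_iff₀ hβ0]; linarith)
  set W : ℝ := ∑' k, w k with hW
  have hW0 : 0 < W := hwsum.tsum_pos (fun k => (hw0 k).le) 0 (hw0 0)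
  set μ : ℕ → ℝ := fun k => w k / W with hμ
  have hμ0 : ∀ k, 0 < μ k := fun k => div_pos (hw0 k) hW0
  have hμrec : ∀ k, μ (k + 1) ≤ τ * μ k := by
    intro k
    have h1 : w (k + 1) ≤ τ * w k := by
      change a (k + 1) / G (k + 1) ^ (1 / β) ≤ τ * (a k / G k ^ (1 / β))
      rw [← mul_div_assoc]
      exact div_le_div₀ (mul_nonneg hτ0.le (ha0 k).le) (harec k)
        (Real.rpow_pos_of_pos (hG0 k) _)
        (Real.rpow_le_rpow (hG0 k).le (hGrec k) (one_div_pos.2 hβ0).le)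
    change w (k + 1) / W ≤ τ * (w k / W)
    rw [← mul_div_assoc]
    exact div_le_div_of_nonneg_right h1 hW0.le
  obtain ⟨f, hf, hfc, x, y, hxy, hval⟩ := exists_mem_lipClass_of_widths hp hα hα1
    (θ := τ / 2) (by positivity) (by linarith) hμ0 (fun K => by
      simp only [hμ]
      rw [← Finset.sum_div, div_le_one hW0]
      exact hwsum.sum_le_tsum _ fun k _ => (hw0 k).le) (fun k => by
      have h1 := hμrec k
      rw [pow_succ', div_mul_div_comm]
      exact div_le_div_of_nonneg_right h1 (by positivity))
  intro hsub
  obtain ⟨g, hgc, hgf, -, hgv⟩ := hsub f hf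
  have hgeq : g = f := (Continuous.ae_eq_iff_eq volume hgc hfc).1 hgf
  rw [hgeq] at hgv
  set V : ℝ := (lambdaVariation l f).toReal with hV
  set H : ℕ → ℝ := fun k => (μ k / 2 ^ k) ^ α * μ k ^ (-(1 / p)) with hH
  have hH0 : ∀ k, 0 < H k := fun k => by
    have := hμ0 k
    simp only [hH]; positivity
  have hl0 : ∀ n, 0 < l (n + 1) := fun n => hl.pos _ (by omega)
  have hpartial : ∀ N, ∑ n ∈ Finset.range N, H (Nat.log 2 (n + 1)) / l (n + 1) ≤ V := by
    intro N
    have h1 : ∑' n, ENNReal.ofReal (|f (y n) - f (x n)| / l (n + 1)) ≤ lambdaVariation l f := by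
      unfold lambdaVariation
      exact le_iSup_of_le x (le_iSup_of_le y (le_iSup_of_le hxy le_rfl))
    have h2 := (ENNReal.sum_le_tsum (Finset.range N)).trans h1
    rw [← ENNReal.ofReal_sum_of_nonneg fun n _ => div_nonneg (abs_nonneg _) (hl0 n).le,
      ENNReal.ofReal_le_iff_le_toReal hgv.ne] at h2
    simpa only [hval] using h2
  -- A group of `2 ^ k` tents, with the smallest weight of its block, contributes `a k / G k`.
  have hterm : ∀ k, 2 ^ k * (H k / l (2 ^ (k + 1))) = (W ^ β)⁻¹ * (a k / G k) := by
    intro k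
    have hk := hμ0 k
    have h1 : (2 : ℝ) ^ k * H k = μ k ^ β * (2 : ℝ) ^ ((k : ℝ) * (1 - α)) := by
      simp only [hH]
      rw [Real.div_rpow hk.le (by positivity), hβ, sub_eq_add_neg, Real.rpow_add hk, mul_sub,
        mul_one, Real.rpow_sub two_pos, Real.rpow_natCast, Real.rpow_mul two_pos.le,
        Real.rpow_natCast]
      ring
    have h2 : μ k ^ β = (W ^ β)⁻¹ * (a k ^ β / G k) := by
      simp only [hμ, hw]
      rw [Real.div_rpow (hw0 k).le hW0.le, Real.div_rpow (ha0 k).le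
        (Real.rpow_nonneg (hG0 k).le _), ← Real.rpow_mul (hG0 k).le, one_div_mul_cancel hβ0.ne',
        Real.rpow_one]
      ring
    have h3 : a k ^ β * c k = a k := by
      simp only [ha]
      rw [← Real.rpow_mul (hc0 k).le, ← Real.rpow_add_one (hc0 k).ne']
      congr 1
      rw [hq']; field_simp; ring
    calc 2 ^ k * (H k / l (2 ^ (k + 1))) = (2 ^ k * H k) / l (2 ^ (k + 1)) := by ring
      _ = μ k ^ β * c k := by rw [h1]; simp only [hc]; ring
      _ = (W ^ β)⁻¹ * ((a k ^ β * c k) / G k) := by rw [h2]; ring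
      _ = _ := by rw [h3]
  refine not_summable_div_partialSum ha0 hadiv ?_
  have hWβ : 0 < W ^ β := Real.rpow_pos_of_pos hW0 _
  refine summable_of_sum_range_le (c := W ^ β * V) (fun k => (div_pos (ha0 k) (hG0 k)).le)
    fun K => ?_
  have h1 : (W ^ β)⁻¹ * ∑ k ∈ Finset.range K, a k / G k ≤ V := by
    rw [Finset.mul_sum]
    refine le_trans ?_ (hpartial (2 ^ K - 1))
    rw [sum_range_two_pow_sub_one]
    refine Finset.sum_le_sum fun k _ => ?_
    rw [← hterm k]
    have h2 := Finset.card_nsmul_le_sum (Finset.range (2 ^ k))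
      (fun i => H (Nat.log 2 (2 ^ k - 1 + i + 1)) / l (2 ^ k - 1 + i + 1))
      (H k / l (2 ^ (k + 1))) fun i hi => by
        have hi' := Finset.mem_range.1 hi
        rw [log_two_block hi']
        have h3 := hl.mono (2 ^ k - 1 + i + 1) (2 ^ (k + 1)) (by omega)
          (by rw [pow_succ]; omega)
        have h4 := hl0 (2 ^ k - 1 + i)
        have h5 := (hH0 k).le
        gcongr
    simpa [nsmul_eq_mul] using h2
  rwa [inv_mul_le_iff₀ hWβ] at h1

/-! ### A sequence satisfying only the condition with exponent `1 / (1 - α)` -/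

/-- The sequence `l k = k ^ (1 - α) (log k) ^ (1 / q)`, up to constants: on the dyadic block
`[2 ^ n, 2 ^ (n + 1))` it equals `2 ^ (n (1 - α)) (n + 1) ^ (1 / q)`. -/
noncomputable def logPowerSeq (α q : ℝ) (k : ℕ) : ℝ :=
  (2 : ℝ) ^ ((Nat.log 2 k : ℝ) * (1 - α)) * ((Nat.log 2 k : ℝ) + 1) ^ (1 / q)

theorem logPowerSeq_two_pow (α q : ℝ) (n : ℕ) :
    logPowerSeq α q (2 ^ n) = (2 : ℝ) ^ ((n : ℝ) * (1 - α)) * ((n : ℝ) + 1) ^ (1 / q) := by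
  rw [logPowerSeq, Nat.log_pow (by norm_num)]

theorem logPowerSeq_pos (α q : ℝ) (k : ℕ) : 0 < logPowerSeq α q k := by
  unfold logPowerSeq; positivity

theorem logPowerSeq_mono {α q : ℝ} (hα1 : α < 1) (hq : 0 < q) : Monotone (logPowerSeq α q) := by
  intro m n hmn
  have h1 : ((Nat.log 2 m : ℕ) : ℝ) ≤ Nat.log 2 n := by exact_mod_cast Nat.log_mono_right hmn
  have h2 : 0 < 1 - α := by linarith
  unfold logPowerSeq
  gcongr
  norm_num

theorem isLambdaSeq_logPowerSeq {α q : ℝ} (hα0 : 0 < α) (hα1 : α < 1) (hq : 1 ≤ q) :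
    IsLambdaSeq (logPowerSeq α q) := by
  have hq0 : 0 < q := by linarith
  have hmono := logPowerSeq_mono hα1 hq0
  refine ⟨fun n _ => logPowerSeq_pos α q n, fun m n _ hmn => hmono hmn, ?_, ?_⟩
  · refine tendsto_atTop_mono' atTop ?_ (((tendsto_rpow_atTop (one_div_pos.2 hq0)).comp
      (tendsto_atTop_add_const_right atTop (1 : ℝ) tendsto_natCast_atTop_atTop)).comp
      (tendsto_atTop_atTop.2 fun b => ⟨2 ^ b, fun k hk => Nat.le_log_of_pow_le (by norm_num) hk⟩))
    refine Eventually.of_forall fun k => ?_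
    have h0 : (0 : ℝ) ≤ ((Nat.log 2 k : ℝ) + 1) ^ (1 / q) := by positivity
    refine le_mul_of_one_le_left h0 (Real.one_le_rpow (by norm_num) ?_)
    exact mul_nonneg (Nat.cast_nonneg _) (by linarith)
  · intro hsum
    have hsum' : Summable fun k => 1 / logPowerSeq α q k :=
      (summable_nat_add_iff (f := fun k => 1 / logPowerSeq α q k) 1).1 hsum
    have hcond := (summable_condensed_iff_of_nonneg
      (fun k => (one_div_pos.2 (logPowerSeq_pos α q k)).le)
      (fun m n _ hmn => one_div_le_one_div_of_le (logPowerSeq_pos α q m) (hmono hmn))).2 hsum'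
    refine Real.not_summable_one_div_natCast ((summable_nat_add_iff 1).1 ?_)
    refine Summable.of_nonneg_of_le (fun n => by positivity) (fun n => ?_) hcond
    rw [logPowerSeq_two_pow]
    have h1 : (1 : ℝ) ≤ (n : ℝ) + 1 := by linarith [(Nat.cast_nonneg n : (0 : ℝ) ≤ n)]
    have h2 : ((n : ℝ) + 1) ^ (1 / q) ≤ (n : ℝ) + 1 :=
      Real.rpow_le_self_of_one_le h1 ((div_le_one hq0).2 hq)
    have h3 : (2 : ℝ) ^ ((n : ℝ) * (1 - α)) ≤ 2 ^ n := by
      rw [← Real.rpow_natCast]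
      refine Real.rpow_le_rpow_of_exponent_le (by norm_num) ?_
      exact mul_le_of_le_one_right (Nat.cast_nonneg n) (by linarith)
    rw [mul_one_div, Nat.cast_add_one, div_le_div_iff₀ (by positivity) (by positivity), one_mul]
    exact mul_le_mul h3 h2 (by positivity) (by positivity)

theorem summable_logPowerSeq_rpow {α q : ℝ} (hα1 : α < 1) (hq : 0 < q) (hqα : q * (1 - α) < 1) :
    Summable fun n : ℕ => (1 / logPowerSeq α q (n + 1)) ^ (1 / (1 - α)) := by
  have h1α : 0 < 1 - α := by linarith
  have hmono := logPowerSeq_mono hα1 hq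
  refine (summable_nat_add_iff (f := fun k => (1 / logPowerSeq α q k) ^ (1 / (1 - α))) 1).2 ?_
  refine (summable_condensed_iff_of_nonneg
    (fun k => Real.rpow_nonneg (one_div_pos.2 (logPowerSeq_pos α q k)).le _)
    (fun m n _ hmn => Real.rpow_le_rpow (one_div_pos.2 (logPowerSeq_pos α q n)).le
      (one_div_le_one_div_of_le (logPowerSeq_pos α q m) (hmono hmn)) (by positivity))).1 ?_
  have hs : 1 < 1 / (q * (1 - α)) := by rw [lt_div_iff₀ (by positivity)]; linarith
  have hsum := (summable_nat_add_iff (f := fun n : ℕ => 1 / (n : ℝ) ^ (1 / (q * (1 - α)))) 1).2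
    (Real.summable_one_div_nat_rpow.2 hs)
  refine hsum.congr fun n => ?_
  rw [logPowerSeq_two_pow, Real.div_rpow zero_le_one (by positivity), Real.one_rpow,
    Real.mul_rpow (by positivity) (by positivity), ← Real.rpow_mul (by positivity),
    ← Real.rpow_mul (by positivity), mul_assoc, mul_one_div_cancel h1α.ne', mul_one,
    Real.rpow_natCast, one_div_mul_one_div]
  push_cast
  field_simp

theorem not_summable_dyadicRatio_logPowerSeq {α q : ℝ} (hq : 0 < q) :
    ¬ Summable fun n => dyadicRatio α (logPowerSeq α q) n ^ q := by
  intro hsum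
  refine Real.not_summable_one_div_natCast ((summable_nat_add_iff 1).1 (hsum.congr fun n => ?_))
  have h1 : dyadicRatio α (logPowerSeq α q) n = (((n : ℝ) + 1) ^ (1 / q))⁻¹ := by
    rw [dyadicRatio, logPowerSeq_two_pow]; field_simp
  rw [h1, Real.inv_rpow (by positivity), ← Real.rpow_mul (by positivity),
    one_div_mul_cancel hq.ne', Real.rpow_one]
  push_cast
  rw [one_div]

/-! ### The characterization and the counterexample -/

theorem theorem1 (p α p' r' : ℝ) (hp : 1 < p) (hα : 1 / p < α) (hα1 : α < 1)
    (hp' : p' = p / (p - 1)) (hr' : r' = 1 / (1 + 1 / p - α)) :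
    (∀ l : ℕ → ℝ, IsLambdaSeq l →
      (LipSubsetLambdaBV α p l ↔
        Summable (fun n : ℕ =>
          (∑ k ∈ Finset.Icc ((2 : ℕ) ^ n) ((2 : ℕ) ^ (n + 1)),
            (1 / ((k : ℝ) ^ (α - 1 / p) * l k)) ^ p') ^ (r' / p')))) ∧
    ∃ l : ℕ → ℝ, IsLambdaSeq l ∧
      Summable (fun n : ℕ => (1 / l (n + 1)) ^ (1 / (1 - α))) ∧
      ¬ LipSubsetLambdaBV α p l := by
  have hp0 : 0 < p := by linarith
  have h1p : 0 < 1 / p := by positivity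
  have hpp : p.HolderConjugate p' := by
    rw [hp']; exact Real.HolderConjugate.conjExponent hp
  have hden : 0 < 1 + 1 / p - α := by linarith
  have hr0 : 0 < r' := by rw [hr']; positivity
  have hr1 : 1 ≤ r' := by rw [hr', le_div_iff₀ hden]; linarith
  refine ⟨fun l hl => ?_, logPowerSeq α r', isLambdaSeq_logPowerSeq (by linarith) hα1 hr1,
    summable_logPowerSeq_rpow hα1 hr0 ?_, ?_⟩
  · rw [summable_blocks_iff hpp hα hr0 hl]
    constructor
    · intro h
      by_contra hns
      exact not_lipSubsetLambdaBV_of_not_summable hp hα hα1 hr' hl hns h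
    · exact lipSubsetLambdaBV_of_summable hpp hα hα1 hr' hl
  · rw [hr', one_div_mul_eq_div, div_lt_one hden]; linarith
  · exact not_lipSubsetLambdaBV_of_not_summable hp hα hα1 hr'
      (isLambdaSeq_logPowerSeq (by linarith) hα1 hr1) (not_summable_dyadicRatio_logPowerSeq hr0)
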